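/- Let $\mathbf p=(p_1,\dots,p_n)$ be $n$ polynomials in $\mathbb C[\mathbf s]=\mathbb C[s_1,\dots,s_n]$ whose common zero set $\mathbf p^{-1}(0)=\{w_1,\dots,w_m\}\subset\mathbb C^n$ is finite and non-empty ($w_1,\dots,w_m$ distinct). Let $N(\mathbf p)=\dim_{\mathbb C}\mathbb C[\mathbf s]/(\mathbf p)$ and let $\mathbf s^{\beta_0},\dots,\mathbf s^{\beta_{N(\mathbf p)-1}}$ be monomials whose classes form a basis of the $\mathbb C$-vector space $\mathbb C[\mathbf s]/(\mathbf p)$ (for example the monomials divisible by no leading monomial of a Gröbner basis of $(\mathbf p)$ for some monomial order). Let $h_{w_1},\dots,h_{w_m}$ be germs of holomorphic functions, $h_{w_j}\in\mathcal O_{\mathbb C^n,w_j}$. 1. There is a unique $(\alpha_0,\dots,\alpha_{N(\mathbf p)-1})\in\mathbb C^{N(\mathbf p)}$ such that, for each $j=1,\dots,m$, in the local ring $\mathcal O_{\mathbb C^n,w_j}$, $$h_{w_j}-\Big(\mathbf s\mapsto\sum_{k=0}^{N(\mathbf p)-1}\alpha_k\,\mathbf s^{\beta_k}\Big)_{w_j}\in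 \mathcal O_{\mathbb C^n,w_j}\,p_{1,w_j}+\cdots+\mathcal O_{\mathbb C^n,w_j}\,p_{n,w_j}.$$ 2. These are the coordinates, in the basis $\mathbf s^{\beta_0},\dots,\mathbf s^{\beta_{N(\mathbf p)-1}}$ (with $\mathbf s$ renamed $\mathbf z$), of the class in $\mathbb C[\mathbf z]/(\mathbf p(\mathbf z))$ of the Lagrange interpolator, defined as follows. * For $g\in\mathbb C[\mathbf s]$ the residue $\mathrm{Res}\begin{bmatrix} g\,ds_1\wedge\cdots\wedge ds_n\\ p_1,\dots,p_n\end{bmatrix}$ is obtained by choosing monic univariate polynomials $q_1(s_1),\dots,q_n(s_n)$ and a matrix $\mathbf A\in\mathcal M_{n,n}(\mathbb C[\mathbf s])$ with $(q_1,\dots,q_n)^t=\mathbf A\,(p_1,\dots,p_n)^t$, and by taking the coefficient of $s_1^{\deg q_1-1}\cdots s_n^{\deg q_n-1}$ in the remainder of $g\det\mathbf A$ after the successive Euclidean divisions by $q_1(s_1),\dots,q_n(s_n)$. * There is a unique family of polynomials $\mathcal Q_{w_1},\dots,\mathcal Q_{w_m}$ in $n$ variables such that, for all such $(q_1,\dots,q_n,\mathbf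 A)$ and all $g\in\mathbb C[\mathbf s]$, this residue equals $\sum_{j=1}^m\mathcal Q_{w_j}(\partial/\partial\mathbf s)[g](w_j)$. * The Noetherian operators at $w_j$ are the $\mathcal Q_{w_j,\ell}(\partial/\partial\mathbf s)$, $\ell\in A_{w_j}$, of the Leibniz expansion $\mathcal Q_{w_j}(\partial/\partial\mathbf s)[f\varphi]=\sum_{\ell\in A_{w_j}}\frac{\partial^{|\ell|}\varphi}{\partial\mathbf s^\ell}\,\mathcal Q_{w_j,\ell}(\partial/\partial\mathbf s)[f]$; that is, $\mathcal Q_{w_j,\ell}=\frac1{\ell!}\,\partial^\ell\mathcal Q_{w_j}$, and $A_{w_j}$ is the finite set of the $\ell\in\mathbb N^n$ that are componentwise at most some exponent occurring in $\mathcal Q_{w_j}$. * A Bézoutian matrix of $\mathbf p$ is a matrix $\mathbf B=[b_{j,k}]\in\mathcal M_{n,n}(\mathbb C[\mathbf s,\mathbf z])$ with $p_j(\mathbf s)-p_j(\mathbf z)=\sum_{k=1}^n b_{j,k}(\mathbf s,\mathbf z)(s_k-z_k)$ for $j=1,\dots,n$; such matrices exist. For every Bézoutian matrix $\mathbf B$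 of $\mathbf p$, the following two expressions define the same polynomial in $\mathbb C[\mathbf z]$, the Lagrange interpolator: $$\sum_{j=1}^m\sum_{\ell\in A_{w_j}}\frac{\partial^{|\ell|}h_{w_j}}{\partial\mathbf s^\ell}(w_j)\;\mathcal Q_{w_j,\ell}(\partial/\partial\mathbf s)\big[\det\mathbf B(\mathbf s,\mathbf z)\big](w_j)=\sum_{j=1}^m\sum_{\ell\in A_{w_j}}\frac{\partial^{|\ell|}\det\mathbf B(\mathbf s,\mathbf z)}{\partial\mathbf s^\ell}\Big|_{\mathbf s=w_j}\;\mathcal Q_{w_j,\ell}(\partial/\partial\mathbf s)[h_{w_j}](w_j),$$ and its class in $\mathbb C[\mathbf z]/(\mathbf p(\mathbf z))$ is $\sum_{k}\alpha_k\,\dot{\mathbf z}^{\beta_k}$. -/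

import Mathlib

open Filter Topology

noncomputable section

namespace ResidueInterpolation

/-! ### Polynomial systems and monomial bases -/

/-- The common zero set in `ℂⁿ` of the polynomials `p₁, …, pₙ`. -/
def zeroSet {n : ℕ} (p : Fin n → MvPolynomial (Fin n) ℂ) : Set (Fin n → ℂ) :=
  {x | ∀ j, MvPolynomial.eval x (p j) = 0}

/-- The ideal `(p₁, …, pₙ)` of `ℂ[s₁, …, sₙ]`. -/
def polyIdeal {n : ℕ} (p : Fin n → MvPolynomial (Fin n) ℂ) : Ideal (MvPolynomial (Fin n) ℂ) :=
  Ideal.span (Set.range p)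

/-- `N(p)`, the dimension of the complex vector space `ℂ[s] / (p)`. -/
def quotDim {n : ℕ} (p : Fin n → MvPolynomial (Fin n) ℂ) : ℕ :=
  Module.finrank ℂ (MvPolynomial (Fin n) ℂ ⧸ polyIdeal p)

/-- The class of the monomial `s ^ b` in `ℂ[s] / (p)`. -/
def monomialClass {n : ℕ} (p : Fin n → MvPolynomial (Fin n) ℂ) (b : Fin n →₀ ℕ) :
    MvPolynomial (Fin n) ℂ ⧸ polyIdeal p :=
  Ideal.Quotient.mk (polyIdeal p) (MvPolynomial.monomial b 1)

/-- The classes of the monomials `s ^ (β k)` form a basis of the vector space `ℂ[s] / (p)`. -/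
def IsMonomialBasis {n : ℕ} {ι : Type*} (p : Fin n → MvPolynomial (Fin n) ℂ)
    (β : ι → Fin n →₀ ℕ) : Prop :=
  LinearIndependent ℂ (fun k => monomialClass p (β k)) ∧
    Submodule.span ℂ (Set.range fun k => monomialClass p (β k)) = ⊤

/-- For every monomial order, the monomials that are divisible by no leading monomial of a nonzero
element of `(p)`, that is by no leading monomial of a Gröbner basis of `(p)`, form such a basis. -/
theorem isMonomialBasis_standard {n : ℕ} (p : Fin n → MvPolynomial (Fin n) ℂ) (m : MonomialOrder (Fin n)) :
    IsMonomialBasis p (fun b : {b : Fin n →₀ ℕ // ∀ f ∈ polyIdeal p, f ≠ 0 → ¬ m.degree f ≤ b} =>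
      (b : Fin n →₀ ℕ)) := by
  have hmk : ∀ (b : Fin n →₀ ℕ) (c : ℂ), Ideal.Quotient.mk (polyIdeal p)
      (MvPolynomial.monomial b c) = c • monomialClass p b := by
    intro b c
    rw [monomialClass, ← Ideal.Quotient.mkₐ_eq_mk ℂ, ← map_smul, MvPolynomial.smul_monomial]
    simp
  constructor
  · rw [linearIndependent_iff']
    intro s g hs
    let f : MvPolynomial (Fin n) ℂ := ∑ i ∈ s, MvPolynomial.monomial (i : Fin n →₀ ℕ) (g i)
    have hf : f ∈ polyIdeal p := by
      rw [← Ideal.Quotient.eq_zero_iff_mem, map_sum, ← hs]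
      exact Finset.sum_congr rfl fun i _ => hmk _ _
    have hc : ∀ b, f.coeff b = ∑ i ∈ s, if (i : Fin n →₀ ℕ) = b then g i else 0 := by
      intro b
      simp only [f, MvPolynomial.coeff_sum, MvPolynomial.coeff_monomial]
    have h0 : f = 0 := by
      by_contra hne
      have hd : f.coeff (m.degree f) ≠ 0 := m.leadingCoeff_ne_zero_iff.mpr hne
      rw [hc] at hd
      obtain ⟨i, -, hi⟩ := Finset.exists_ne_zero_of_sum_ne_zero hd
      have hi' : (i : Fin n →₀ ℕ) = m.degree f := by
        by_contra h
        simp [h] at hi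
      exact i.2 f hf hne hi'.ge
    intro i hi
    have := hc i
    rw [h0] at this
    simp only [MvPolynomial.coeff_zero, Subtype.coe_inj, Finset.sum_ite_eq', hi, if_true] at this
    exact this.symm
  · rw [eq_top_iff]
    rintro x -
    obtain ⟨f, rfl⟩ := Ideal.Quotient.mk_surjective x
    obtain ⟨g, r, hfr, -, hr⟩ := m.div_set (B := {b | b ∈ polyIdeal p ∧ b ≠ 0})
      (fun b hb => (m.leadingCoeff_ne_zero_iff.mpr hb.2).isUnit) f
    have hg : Finsupp.linearCombination (MvPolynomial (Fin n) ℂ)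
        (fun b : {b | b ∈ polyIdeal p ∧ b ≠ 0} => (b : MvPolynomial (Fin n) ℂ)) g ∈ polyIdeal p := by
      rw [Finsupp.linearCombination_apply]
      exact Ideal.sum_mem _ fun b _ => Ideal.mul_mem_left _ _ b.2.1
    rw [hfr, map_add, Ideal.Quotient.eq_zero_iff_mem.mpr hg, zero_add, r.as_sum, map_sum]
    refine Submodule.sum_mem _ fun c hc => ?_
    rw [hmk]
    exact Submodule.smul_mem _ _ (Submodule.subset_span
      ⟨⟨c, fun b hb hne => hr c hc b ⟨hb, hne⟩⟩, rfl⟩)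

/-! ### Germs of holomorphic functions -/

/-- The local ring `𝒪_{ℂⁿ, x}` of germs at `x` of holomorphic functions, as a subring of the ring
of all germs of functions at `x`. -/
def HolGerm {n : ℕ} (x : Fin n → ℂ) : Subring (Germ (𝓝 x) ℂ) where
  carrier := {g | ∃ f : (Fin n → ℂ) → ℂ, AnalyticAt ℂ f x ∧ (f : Germ (𝓝 x) ℂ) = g}
  mul_mem' := by
    rintro _ _ ⟨f, hf, rfl⟩ ⟨g, hg, rfl⟩
    exact ⟨f * g, hf.mul hg, rfl⟩
  one_mem' := ⟨fun _ => 1, analyticAt_const, rfl⟩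
  add_mem' := by
    rintro _ _ ⟨f, hf, rfl⟩ ⟨g, hg, rfl⟩
    exact ⟨f + g, hf.add hg, rfl⟩
  zero_mem' := ⟨fun _ => 0, analyticAt_const, rfl⟩
  neg_mem' := by
    rintro _ ⟨f, hf, rfl⟩
    exact ⟨-f, hf.neg, rfl⟩

/-- The germ at `x` of the polynomial function `s ↦ P(s)`. -/
def polyGerm {n : ℕ} (x : Fin n → ℂ) (P : MvPolynomial (Fin n) ℂ) : HolGerm x :=
  ⟨((fun s => MvPolynomial.eval s P : (Fin n → ℂ) → ℂ) : Germ (𝓝 x) ℂ),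
    fun s => MvPolynomial.eval s P, AnalyticOnNhd.eval_mvPolynomial P x (Set.mem_univ x), rfl⟩

/-- The ideal generated by the germs of `p₁, …, pₙ` in the local ring `𝒪_{ℂⁿ, x}`. -/
def localIdeal {n : ℕ} (p : Fin n → MvPolynomial (Fin n) ℂ) (x : Fin n → ℂ) :
    Ideal (HolGerm x) :=
  Ideal.span (Set.range fun i => polyGerm x (p i))

/-- The polynomial `∑ₖ αₖ s ^ βₖ`. -/
def combination {n N : ℕ} (β : Fin N → Fin n →₀ ℕ) (α : Fin N → ℂ) : MvPolynomial (Fin n) ℂ :=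
  ∑ k, MvPolynomial.monomial (β k) (α k)

/-- For each `j`, the germ `h j` at `w j` and the polynomial `∑ₖ αₖ s ^ βₖ` agree modulo the ideal
generated by `p₁, …, pₙ` in `𝒪_{ℂⁿ, w j}`. -/
def Interpolates {n m N : ℕ} (p : Fin n → MvPolynomial (Fin n) ℂ) (w : Fin m → Fin n → ℂ)
    (β : Fin N → Fin n →₀ ℕ) (h : ∀ j, HolGerm (w j)) (α : Fin N → ℂ) : Prop :=
  ∀ j, h j - polyGerm (w j) (combination β α) ∈ localIdeal p (w j)

/-! ### Differential operators with constant coefficients -/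

/-- The partial derivative `∂f/∂sᵢ` of a function on `ℂⁿ`. -/
def partialDeriv {n : ℕ} (i : Fin n) (f : (Fin n → ℂ) → ℂ) : (Fin n → ℂ) → ℂ :=
  fun s => fderiv ℂ f s (Pi.single i 1)

/-- The iterated partial derivative `∂^|l| f / ∂s^l`. -/
def iterPartial {n : ℕ} (l : Fin n →₀ ℕ) (f : (Fin n → ℂ) → ℂ) : (Fin n → ℂ) → ℂ :=
  (List.finRange n).foldr (fun i g => (partialDeriv i)^[l i] g) f

theorem iterPartial_congr {n : ℕ} (l : Fin n →₀ ℕ) {x : Fin n → ℂ} {f g : (Fin n → ℂ) → ℂ}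
    (hfg : f =ᶠ[𝓝 x] g) : iterPartial l f =ᶠ[𝓝 x] iterPartial l g := by
  unfold iterPartial
  induction List.finRange n with
  | nil => exact hfg
  | cons i t ih =>
    simp only [List.foldr_cons]
    induction l i with
    | zero => exact ih
    | succ k ihk =>
      rw [Function.iterate_succ_apply', Function.iterate_succ_apply']
      filter_upwards [ihk.fderiv (𝕜 := ℂ)] with s hs
      simp only [partialDeriv, hs]

/-- The value at `x` of the derivative `∂^|l| / ∂s^l` of a germ at `x`. -/
def germDeriv {n : ℕ} {x : Fin n → ℂ} (l : Fin n →₀ ℕ) (g : Germ (𝓝 x) ℂ) : ℂ :=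
  Quotient.liftOn' g (fun f => iterPartial l f x) fun _ _ hfg =>
    (iterPartial_congr l hfg).eq_of_nhds

/-- The iterated partial derivative `∂^|l| P / ∂s^l` of a polynomial with coefficients in `R`. -/
def polyIterPartial {n : ℕ} {R : Type*} [CommRing R] (l : Fin n →₀ ℕ)
    (P : MvPolynomial (Fin n) R) : MvPolynomial (Fin n) R :=
  (List.finRange n).foldr (fun i g => (MvPolynomial.pderiv i)^[l i] g) P

/-- The value at the point `x` of a polynomial in `s` with coefficients in a complex algebra. -/
def evalAt {n : ℕ} {R : Type*} [CommRing R] [Algebra ℂ R] (x : Fin n → ℂ)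
    (P : MvPolynomial (Fin n) R) : R :=
  MvPolynomial.eval (fun i => algebraMap ℂ R (x i)) P

/-- `Q(∂/∂s)[g](x)` for a germ `g` at `x`. The differential operator with constant coefficients
`Q(∂/∂s)` is given by the polynomial `Q`, its symbol. -/
def applyGerm {n : ℕ} {x : Fin n → ℂ} (Q : MvPolynomial (Fin n) ℂ) (g : Germ (𝓝 x) ℂ) : ℂ :=
  ∑ l ∈ Q.support, Q.coeff l * germDeriv l g

/-- `Q(∂/∂s)[P](x)` for a polynomial `P` in `s` with coefficients in a complex algebra `R`. -/
def applyPoly {n : ℕ} {R : Type*} [CommRing R] [Algebra ℂ R] (Q : MvPolynomial (Fin n) ℂ)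
    (x : Fin n → ℂ) (P : MvPolynomial (Fin n) R) : R :=
  ∑ l ∈ Q.support, Q.coeff l • evalAt x (polyIterPartial l P)

/-! ### The residue and the Noetherian operators -/

/-- The identity `(q₁(s₁), …, qₙ(sₙ)) = A(s) · (p₁(s), …, pₙ(s))` with `q₁, …, qₙ` monic
univariate polynomials. -/
def IsUnivariateReduction {n : ℕ} (p : Fin n → MvPolynomial (Fin n) ℂ) (q : Fin n → Polynomial ℂ)
    (A : Matrix (Fin n) (Fin n) (MvPolynomial (Fin n) ℂ)) : Prop :=
  (∀ j, (q j).Monic) ∧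
    ∀ j, Polynomial.aeval (MvPolynomial.X j : MvPolynomial (Fin n) ℂ) (q j) = ∑ k, A j k * p k

/-- The remainder of `g` after the successive Euclidean divisions by `q₁(s₁), …, qₙ(sₙ)`: each
monomial `s₁ ^ l₁ ⋯ sₙ ^ lₙ` of `g` is replaced by the product over `j` of the remainders of
`sⱼ ^ lⱼ` modulo `qⱼ(sⱼ)`. -/
def euclidRemainder {n : ℕ} (q : Fin n → Polynomial ℂ) (g : MvPolynomial (Fin n) ℂ) :
    MvPolynomial (Fin n) ℂ :=
  ∑ l ∈ g.support, MvPolynomial.C (g.coeff l) *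
    ∏ j, Polynomial.aeval (MvPolynomial.X j : MvPolynomial (Fin n) ℂ)
      ((Polynomial.X ^ (l j) : Polynomial ℂ) %ₘ q j)

/-- The residue of `g ds₁ ∧ ⋯ ∧ dsₙ` with respect to `p₁, …, pₙ`, computed from `q` and `A` such
that `q = A p`: the coefficient of `s₁ ^ (deg q₁ - 1) ⋯ sₙ ^ (deg qₙ - 1)` in the remainder of
`g · det A` after the successive Euclidean divisions by `q₁(s₁), …, qₙ(sₙ)`. -/
def residueVia {n : ℕ} (q : Fin n → Polynomial ℂ)
    (A : Matrix (Fin n) (Fin n) (MvPolynomial (Fin n) ℂ)) (g : MvPolynomial (Fin n) ℂ) : ℂ :=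
  (euclidRemainder q (g * A.det)).coeff (Finsupp.equivFunOnFinite.symm fun j => (q j).natDegree - 1)

/-- `Q₁, …, Qₘ` are the symbols of the differential operators at the zeros `w₁, …, wₘ` that
represent the residue of `p₁, …, pₙ`, that is `Res[g ds / p] = ∑ⱼ Qⱼ(∂/∂s)[g](wⱼ)`, whatever the
`q` and `A` from which this residue is computed. -/
def RepresentsResidue {n m : ℕ} (p : Fin n → MvPolynomial (Fin n) ℂ) (w : Fin m → Fin n → ℂ)
    (Q : Fin m → MvPolynomial (Fin n) ℂ) : Prop :=
  ∀ (q : Fin n → Polynomial ℂ) (A : Matrix (Fin n) (Fin n) (MvPolynomial (Fin n) ℂ)),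
    IsUnivariateReduction p q A →
      ∀ g : MvPolynomial (Fin n) ℂ, residueVia q A g = ∑ j, applyPoly (Q j) (w j) g

/-- The finite set of multi-exponents `l` that occur in the Leibniz expansion
`Q(∂/∂s)[f φ] = ∑ₗ ∂^l[φ] · Q_l(∂/∂s)[f]`, that is those below some exponent of `Q`. -/
def noetherianSupport {n : ℕ} (Q : MvPolynomial (Fin n) ℂ) : Finset (Fin n →₀ ℕ) :=
  Q.support.biUnion Finset.Iic

/-- The symbol `Q_l = (1 / l!) ∂^l Q` of the operator `Q_l(∂/∂s)` in the Leibniz expansion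
`Q(∂/∂s)[f φ] = ∑ₗ ∂^l[φ] · Q_l(∂/∂s)[f]`. -/
def noetherianComponent {n : ℕ} (Q : MvPolynomial (Fin n) ℂ) (l : Fin n →₀ ℕ) :
    MvPolynomial (Fin n) ℂ :=
  MvPolynomial.C ((∏ i, ((l i).factorial : ℂ))⁻¹) * polyIterPartial l Q

/-! ### The Lagrange interpolator -/

/-- `B` is a Bézoutian matrix of `p`: `pⱼ(s) - pⱼ(z) = ∑ₖ Bⱼₖ(s, z) (sₖ - zₖ)`. Polynomials in
`(s, z)` are polynomials in `s` with coefficients in `ℂ[z]`. -/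
def IsBezoutian {n : ℕ} (p : Fin n → MvPolynomial (Fin n) ℂ)
    (B : Matrix (Fin n) (Fin n) (MvPolynomial (Fin n) (MvPolynomial (Fin n) ℂ))) : Prop :=
  ∀ j, MvPolynomial.map MvPolynomial.C (p j) - MvPolynomial.C (p j) =
    ∑ k, B j k * (MvPolynomial.X k - MvPolynomial.C (MvPolynomial.X k))

/-- The Lagrange interpolator, a polynomial in `z`, in its first form
`∑ⱼ ∑ₗ ∂^l[hⱼ](wⱼ) · Qⱼₗ(∂/∂s)[det B(s, z)](wⱼ)`. -/
def lagrange {n m : ℕ} (w : Fin m → Fin n → ℂ) (Q : Fin m → MvPolynomial (Fin n) ℂ)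
    (B : Matrix (Fin n) (Fin n) (MvPolynomial (Fin n) (MvPolynomial (Fin n) ℂ)))
    (h : ∀ j, HolGerm (w j)) : MvPolynomial (Fin n) ℂ :=
  ∑ j, ∑ l ∈ noetherianSupport (Q j),
    MvPolynomial.C (germDeriv l (h j : Germ (𝓝 (w j)) ℂ)) *
      applyPoly (noetherianComponent (Q j) l) (w j) B.det

/-- The Lagrange interpolator, a polynomial in `z`, in its second form
`∑ⱼ ∑ₗ ∂^l[det B(s, z)](wⱼ) · Qⱼₗ(∂/∂s)[hⱼ](wⱼ)`. -/
def lagrange' {n m : ℕ} (w : Fin m → Fin n → ℂ) (Q : Fin m → MvPolynomial (Fin n) ℂ)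
    (B : Matrix (Fin n) (Fin n) (MvPolynomial (Fin n) (MvPolynomial (Fin n) ℂ)))
    (h : ∀ j, HolGerm (w j)) : MvPolynomial (Fin n) ℂ :=
  ∑ j, ∑ l ∈ noetherianSupport (Q j),
    evalAt (w j) (polyIterPartial l B.det) *
      MvPolynomial.C (applyGerm (noetherianComponent (Q j) l) (h j : Germ (𝓝 (w j)) ℂ))

end ResidueInterpolation

end

/-! The residue is a linear form on ℂ[s] that vanishes on (p), and det B(s, z) is a reproducing
kernel for it: Res_s[f(s) det B(s, z)] ≡ f(z) modulo (p(z)). Once the residue is written as ∑ⱼ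
Qⱼ(∂/∂s)[·](wⱼ), the Leibniz formula for the product f · det B yields the interpolator, in either
form according to which factor plays the role of φ. Only finitely many derivatives of the germs hⱼ
enter, so all the germs may be replaced by one polynomial T with the same Taylor expansions up to a
high order.

The kernel property is proved over any nonzero algebra R with φ : ℂ[z] → R killing p; then z becomes
an R-valued zero of p. Cramer's rule puts (sₖ - zₖ) det B in (p(s)), and f(s) ≡ f(z) modulo (s - z),
so that only Res[det B] = 1 remains. This is the residue of det(AB) with respect to the qⱼ(sⱼ), and
AB writes the qⱼ(sⱼ) as combinations of the sₖ - zₖ. By `det_sub_det_mem` all matrices doing this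
have the same determinant modulo (q), and the diagonal one, with entries qⱼ(sⱼ)/(sⱼ - zⱼ), visibly
has residue 1. Two residues computed from different (q, A) are compared by applying one in s and the
other in z to f(s) det B(s, z) (`residueForm_unique`).

The passage between global and local rests on `exists_mem_polyIdeal_of_mem_pow`: by the
Nullstellensatz and noetherianity, vanishing to a high order M at every wⱼ forces membership in (p).
With the Chinese remainder theorem this gives q and A, turns every linear form that kills (p) into
differential operators at the wⱼ, and reduces membership in (p) to the local rings. On the analytic
side, Hadamard's lemma makes each germ a polynomial modulo any power of the maximal ideal. Existence
and uniqueness of α follow. -/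

noncomputable section

namespace ResidueInterpolation

open MvPolynomial

/-! ### Translations and Taylor coefficients -/

section Translate

variable {n : ℕ} {R : Type*} [CommRing R]

/-- The substitution `s ↦ s + a`. -/
def translate (a : Fin n → R) : MvPolynomial (Fin n) R →ₐ[R] MvPolynomial (Fin n) R :=
  aeval fun i => X i + C (a i)

theorem translate_X (a : Fin n → R) (i : Fin n) : translate a (X i) = X i + C (a i) := by
  simp [translate]

theorem translate_C (a : Fin n → R) (c : R) : translate a (C c) = C c := by
  simp [translate]

theorem translate_X_sub_C (a : Fin n → R) (i : Fin n) : translate a (X i - C (a i)) = X i := by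
  rw [map_sub, translate_X, translate_C, add_sub_cancel_right]

theorem translate_neg_translate (a : Fin n → R) (P : MvPolynomial (Fin n) R) :
    translate (-a) (translate a P) = P := by
  have : (translate (-a)).comp (translate a) = AlgHom.id R _ := by
    ext i : 1
    simp [translate_X]
  exact DFunLike.congr_fun this P

theorem translate_injective (a : Fin n → R) : Function.Injective (translate a) :=
  Function.LeftInverse.injective (translate_neg_translate a)

theorem coeff_zero_translate (a : Fin n → R) (P : MvPolynomial (Fin n) R) :
    coeff 0 (translate a P) = eval a P := by
  have : (aeval (0 : Fin n → R)).comp (translate a) = aeval a := by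
    ext i : 1
    simp [translate_X]
  have h := DFunLike.congr_fun this P
  rw [← constantCoeff_eq]
  simpa [aeval_zero, aeval_eq_eval] using h

/-- `R` may have zero divisors (it will be ℂ[z]/(p)); a translation reduces to multiplication by the
variable, which only shifts coefficients. -/
theorem X_sub_C_mul_eq_zero {i : Fin n} {c : R} {f : MvPolynomial (Fin n) R}
    (h : (X i - C c) * f = 0) : f = 0 := by
  have h1 := congrArg (translate fun _ => c) h
  rw [map_mul, translate_X_sub_C (fun _ => c), map_zero] at h1
  apply translate_injective fun _ => c
  ext m
  have := congrArg (coeff (Finsupp.single i 1 + m)) h1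
  rw [coeff_X_mul, coeff_zero] at this
  rw [this, map_zero, coeff_zero]

theorem pderiv_translate (a : Fin n → R) (i : Fin n) (P : MvPolynomial (Fin n) R) :
    pderiv i (translate a P) = translate a (pderiv i P) := by
  induction P using MvPolynomial.induction_on with
  | C c => simp
  | add P Q hP hQ => simp [hP, hQ]
  | mul_X P j hP =>
    simp only [map_mul, Derivation.leibniz, hP, translate_X, map_add, smul_eq_mul, pderiv_C,
      add_zero, pderiv_X]
    congr 2
    by_cases h : j = i
    · subst h; simp
    · simp [h]

theorem polyIterPartial_translate (a : Fin n → R) (l : Fin n →₀ ℕ) (P : MvPolynomial (Fin n) R) :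
    polyIterPartial l (translate a P) = translate a (polyIterPartial l P) := by
  unfold polyIterPartial
  induction List.finRange n with
  | nil => rfl
  | cons i t ih =>
    simp only [List.foldr_cons, ih]
    induction l i with
    | zero => rfl
    | succ k ihk => simp only [Function.iterate_succ_apply', ihk, pderiv_translate]

theorem coeff_iterate_pderiv (i : Fin n) (k : ℕ) (P : MvPolynomial (Fin n) R) (m : Fin n →₀ ℕ) :
    coeff m ((pderiv i)^[k] P) =
      coeff (m + Finsupp.single i k) P * ((m i + 1).ascFactorial k : ℕ) := by
  induction k generalizing m with
  | zero => simp
  | succ k ih =>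
    rw [Function.iterate_succ_apply', coeff_pderiv, ih, add_assoc, ← Finsupp.single_add,
      add_comm 1 k, mul_assoc]
    congr 1
    have := Nat.succ_ascFactorial (m i + 1) k
    rw [Nat.ascFactorial_succ, ← this]
    simp only [Finsupp.add_apply, Finsupp.single_eq_same]
    push_cast
    ring

theorem coeff_polyIterPartial (l m : Fin n →₀ ℕ) (P : MvPolynomial (Fin n) R) :
    coeff m (polyIterPartial l P) =
      coeff (m + l) P * ((∏ i, (m i + 1).ascFactorial (l i) : ℕ) : R) := by
  -- Without repetition in the list, differentiating in one variable leaves the exponents that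
  -- govern the other factors unchanged.
  have key : ∀ (t : List (Fin n)), t.Nodup → ∀ m : Fin n →₀ ℕ,
      coeff m (t.foldr (fun i g => (pderiv i)^[l i] g) P) =
        coeff (m + (t.map fun i => Finsupp.single i (l i)).sum) P *
          (((t.map fun i => (m i + 1).ascFactorial (l i)).prod : ℕ) : R) := by
    intro t
    induction t with
    | nil => simp
    | cons i t ih =>
      intro ht m
      obtain ⟨hi, ht⟩ := List.nodup_cons.mp ht
      rw [List.foldr_cons, coeff_iterate_pderiv, ih ht]
      simp only [List.map_cons, List.sum_cons, List.prod_cons, Nat.cast_mul]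
      rw [add_assoc, mul_assoc, mul_comm (Nat.cast (List.prod _))]
      congr 4
      refine List.map_congr_left fun j hj => ?_
      have : i ≠ j := fun h => hi (h ▸ hj)
      simp [this]
  unfold polyIterPartial
  rw [key _ (List.nodup_finRange n), ← Fin.sum_univ_def, ← Fin.prod_univ_def,
    Finsupp.univ_sum_single]

theorem eval_polyIterPartial (a : Fin n → R) (l : Fin n →₀ ℕ) (P : MvPolynomial (Fin n) R) :
    eval a (polyIterPartial l P) =
      coeff l (translate a P) * ((∏ i, (l i).factorial : ℕ) : R) := by
  rw [← coeff_zero_translate, ← polyIterPartial_translate, coeff_polyIterPartial]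
  simp [Nat.one_ascFactorial]

theorem translate_map {S : Type*} [CommRing S] (f : R →+* S) (a : Fin n → R)
    (P : MvPolynomial (Fin n) R) :
    translate (fun i => f (a i)) (map f P) = map f (translate a P) := by
  induction P using MvPolynomial.induction_on with
  | C c => simp
  | add P Q hP hQ => simp [hP, hQ]
  | mul_X P j hP => simp [hP, translate_X]

end Translate

/-! ### Differential operators with constant coefficients -/

section Operators

variable {n : ℕ} {R : Type*} [CommRing R] [Algebra ℂ R]

/-- The coefficients of the Taylor expansion at `x` of a polynomial with coefficients in `R`. -/
def taylorCoeff (x : Fin n → ℂ) (l : Fin n →₀ ℕ) : MvPolynomial (Fin n) R →ₗ[R] R :=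
  lcoeff R l ∘ₗ (translate fun i => algebraMap ℂ R (x i)).toLinearMap

theorem taylorCoeff_apply (x : Fin n → ℂ) (l : Fin n →₀ ℕ) (P : MvPolynomial (Fin n) R) :
    taylorCoeff x l P = coeff l (translate (fun i => algebraMap ℂ R (x i)) P) := rfl

theorem taylorCoeff_mul (x : Fin n → ℂ) (l : Fin n →₀ ℕ) (P P' : MvPolynomial (Fin n) R) :
    taylorCoeff x l (P * P') =
      ∑ ab ∈ Finset.HasAntidiagonal.antidiagonal l, taylorCoeff x ab.1 P * taylorCoeff x ab.2 P' := by
  simp only [taylorCoeff_apply, map_mul, coeff_mul]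

theorem taylorCoeff_map (x : Fin n → ℂ) (l : Fin n →₀ ℕ) (P : MvPolynomial (Fin n) ℂ) :
    taylorCoeff x l (map (algebraMap ℂ R) P) = algebraMap ℂ R (taylorCoeff x l P) := by
  simp only [taylorCoeff_apply, translate_map (algebraMap ℂ R) x P, coeff_map]
  rfl

/-- The product of the factorials of the entries of a multi-exponent. -/
def multiFactorial (l : Fin n →₀ ℕ) : ℕ := ∏ i, (l i).factorial

theorem multiFactorial_ne_zero (l : Fin n →₀ ℕ) : (multiFactorial l : ℂ) ≠ 0 := by
  rw [multiFactorial]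
  exact_mod_cast Finset.prod_ne_zero_iff.mpr fun i _ => (l i).factorial_ne_zero

theorem evalAt_polyIterPartial (x : Fin n → ℂ) (l : Fin n →₀ ℕ) (P : MvPolynomial (Fin n) R) :
    evalAt x (polyIterPartial l P) = (multiFactorial l : ℂ) • taylorCoeff x l P := by
  rw [evalAt, eval_polyIterPartial, taylorCoeff_apply, Algebra.smul_def, map_natCast, mul_comm]
  rfl

theorem applyPoly_eq_sum (Q : MvPolynomial (Fin n) ℂ) (x : Fin n → ℂ)
    (P : MvPolynomial (Fin n) R) {S : Finset (Fin n →₀ ℕ)} (hS : Q.support ⊆ S) :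
    applyPoly Q x P = ∑ l ∈ S, (Q.coeff l * multiFactorial l) • taylorCoeff x l P := by
  rw [applyPoly]
  refine (Finset.sum_subset hS fun l _ hl => ?_).trans (Finset.sum_congr rfl fun l _ => ?_)
  · rw [notMem_support_iff.mp hl, zero_smul]
  · rw [evalAt_polyIterPartial, mul_smul]

/-- In the normalization where each coefficient of Q is multiplied by the factorial of its exponent,
passing to the component Qₐ is a shift by a, up to the factor 1/a!. This is the Leibniz rule on
coefficients. -/
theorem coeff_noetherianComponent (Q : MvPolynomial (Fin n) ℂ) (a b : Fin n →₀ ℕ) :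
    coeff b (noetherianComponent Q a) * multiFactorial b * multiFactorial a =
      coeff (a + b) Q * multiFactorial (a + b) := by
  have h : ((∏ i, (b i + 1).ascFactorial (a i) : ℕ) : ℂ) * multiFactorial b =
      multiFactorial (a + b) := by
    rw [multiFactorial, multiFactorial, ← Nat.cast_mul, ← Finset.prod_mul_distrib]
    congr 1
    refine Finset.prod_congr rfl fun i _ => ?_
    rw [mul_comm, Nat.factorial_mul_ascFactorial, Finsupp.add_apply, add_comm]
  have ha := multiFactorial_ne_zero a
  rw [noetherianComponent, coeff_C_mul, coeff_polyIterPartial, ← h, add_comm a b]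
  rw [show (∏ i, ((a i).factorial : ℂ)) = multiFactorial a by simp [multiFactorial]]
  field_simp

theorem mem_noetherianSupport {Q : MvPolynomial (Fin n) ℂ} {a : Fin n →₀ ℕ} :
    a ∈ noetherianSupport Q ↔ ∃ l ∈ Q.support, a ≤ l := by
  simp [noetherianSupport]

theorem support_noetherianComponent_subset (Q : MvPolynomial (Fin n) ℂ) (a : Fin n →₀ ℕ) :
    (noetherianComponent Q a).support ⊆ noetherianSupport Q := by
  intro b hb
  refine mem_noetherianSupport.mpr ⟨a + b, ?_, le_add_self⟩
  rw [mem_support_iff] at hb ⊢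
  intro h0
  have := coeff_noetherianComponent Q a b
  rw [h0, zero_mul, mul_assoc] at this
  exact mul_ne_zero hb (mul_ne_zero (multiFactorial_ne_zero b) (multiFactorial_ne_zero a)) this

/-- The Leibniz formula `Q(∂/∂s)[φ f] = ∑ₗ ∂^l[φ] · Q_l(∂/∂s)[f]`. -/
theorem applyPoly_mul (Q : MvPolynomial (Fin n) ℂ) (x : Fin n → ℂ)
    (φ f : MvPolynomial (Fin n) R) :
    applyPoly Q x (φ * f) = ∑ l ∈ noetherianSupport Q,
      evalAt x (polyIterPartial l φ) * applyPoly (noetherianComponent Q l) x f := by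
  let t : (Fin n →₀ ℕ) × (Fin n →₀ ℕ) → R := fun ab =>
    (coeff (ab.1 + ab.2) Q * multiFactorial (ab.1 + ab.2)) •
      (taylorCoeff x ab.1 φ * taylorCoeff x ab.2 f)
  have hR : ∀ l, evalAt x (polyIterPartial l φ) * applyPoly (noetherianComponent Q l) x f =
      ∑ b ∈ noetherianSupport Q, t (l, b) := by
    intro l
    rw [applyPoly_eq_sum _ x f (support_noetherianComponent_subset Q l), evalAt_polyIterPartial,
      Finset.mul_sum]
    refine Finset.sum_congr rfl fun b _ => ?_
    simp only [t]
    rw [smul_mul_smul_comm, ← coeff_noetherianComponent, mul_comm (multiFactorial l : ℂ)]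
  simp only [hR]
  rw [← Finset.sum_product', applyPoly_eq_sum Q x _ subset_rfl]
  -- Both sides are sums over pairs (a, b) of Taylor exponents. Pairs with a + b outside the support
  -- of Q contribute zero; the others are grouped according to l = a + b.
  have hz : ∑ ab ∈ noetherianSupport Q ×ˢ noetherianSupport Q, t ab =
      ∑ ab ∈ (noetherianSupport Q ×ˢ noetherianSupport Q).filter
        (fun ab => ab.1 + ab.2 ∈ Q.support), t ab := by
    refine (Finset.sum_filter_of_ne fun ab _ h => ?_).symm
    rw [mem_support_iff]
    intro h0
    simp [t, h0] at h
  rw [hz, ← Finset.sum_fiberwise_of_maps_to (t := Q.support) (f := t)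
    (g := fun ab : (Fin n →₀ ℕ) × (Fin n →₀ ℕ) => ab.1 + ab.2)
    (fun ab h => (Finset.mem_filter.mp h).2)]
  refine Finset.sum_congr rfl fun l hl => ?_
  rw [taylorCoeff_mul, Finset.smul_sum]
  refine Finset.sum_congr ?_ fun ab h => ?_
  · ext ab
    simp only [Finset.HasAntidiagonal.mem_antidiagonal, Finset.mem_filter, Finset.mem_product,
      mem_noetherianSupport]
    constructor
    · rintro rfl
      exact ⟨⟨⟨⟨_, hl, le_self_add⟩, ⟨_, hl, le_add_self⟩⟩, hl⟩, rfl⟩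
    · exact fun h => h.2
  · simp only [Finset.mem_filter] at h
    simp only [t, h.2]

/-- The extension of scalars from `ℂ` to `R` of a linear form on `ℂ[s]`. -/
def extend (R : Type*) [CommRing R] [Algebra ℂ R] (lam : MvPolynomial (Fin n) ℂ →ₗ[ℂ] ℂ) :
    MvPolynomial (Fin n) R →ₗ[R] R :=
  (basisMonomials (Fin n) R).constr R fun l => algebraMap ℂ R (lam (monomial l 1))

theorem extend_monomial (lam : MvPolynomial (Fin n) ℂ →ₗ[ℂ] ℂ) (l : Fin n →₀ ℕ) (c : R) :
    extend R lam (monomial l c) = c * algebraMap ℂ R (lam (monomial l 1)) := by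
  have h := (basisMonomials (Fin n) R).constr_basis R
    (fun l => algebraMap ℂ R (lam (monomial l 1))) l
  rw [coe_basisMonomials] at h
  rw [show monomial l c = c • monomial l (1 : R) by rw [smul_monomial, smul_eq_mul, mul_one],
    map_smul, smul_eq_mul]
  exact congrArg (c * ·) h

theorem extend_map (lam : MvPolynomial (Fin n) ℂ →ₗ[ℂ] ℂ) (f : MvPolynomial (Fin n) ℂ) :
    extend R lam (map (algebraMap ℂ R) f) = algebraMap ℂ R (lam f) := by
  induction f using MvPolynomial.induction_on' with
  | monomial l c =>
    rw [map_monomial, extend_monomial, ← map_mul, ← smul_eq_mul, ← map_smul, smul_monomial,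
      smul_eq_mul, mul_one]
  | add p q hp hq => simp only [map_add, hp, hq]

theorem map_extend {S : Type*} [CommRing S] [Algebra ℂ S] (φ : R →ₐ[ℂ] S)
    (lam : MvPolynomial (Fin n) ℂ →ₗ[ℂ] ℂ) (F : MvPolynomial (Fin n) R) :
    φ (extend R lam F) = extend S lam (map (φ : R →+* S) F) := by
  induction F using MvPolynomial.induction_on' with
  | monomial l c =>
    rw [map_monomial, extend_monomial, extend_monomial, map_mul, AlgHom.commutes]
    rfl
  | add p q hp hq => simp only [map_add, hp, hq]

/-- Reduces an identity between `R`-linear maps to polynomials with complex coefficients. -/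
theorem C_mul_map_monomial_induction {motive : MvPolynomial (Fin n) R → Prop}
    (h : ∀ (c : R) (g : MvPolynomial (Fin n) ℂ), motive (C c * map (algebraMap ℂ R) g))
    (hadd : ∀ F G, motive F → motive G → motive (F + G)) (F : MvPolynomial (Fin n) R) :
    motive F := by
  induction F using MvPolynomial.induction_on' with
  | monomial l c =>
    have := h c (monomial l 1)
    rwa [map_monomial, map_one, C_mul_monomial, mul_one] at this
  | add p q hp hq => exact hadd p q hp hq

theorem extend_C_mul (lam : MvPolynomial (Fin n) ℂ →ₗ[ℂ] ℂ) (c : R)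
    (F : MvPolynomial (Fin n) R) : extend R lam (C c * F) = c * extend R lam F := by
  rw [← smul_eq_C_mul, map_smul, smul_eq_mul]

theorem extend_eq_zero_of_mul (lam : MvPolynomial (Fin n) ℂ →ₗ[ℂ] ℂ)
    {f : MvPolynomial (Fin n) ℂ} (hf : ∀ g, lam (f * g) = 0) (F : MvPolynomial (Fin n) R) :
    extend R lam (map (algebraMap ℂ R) f * F) = 0 := by
  induction F using C_mul_map_monomial_induction with
  | h c g => rw [mul_left_comm, ← map_mul, extend_C_mul, extend_map, hf, map_zero, mul_zero]
  | hadd F G hF hG => rw [mul_add, map_add, hF, hG, add_zero]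

theorem extend_mulLeft (lam : MvPolynomial (Fin n) ℂ →ₗ[ℂ] ℂ) (f : MvPolynomial (Fin n) ℂ)
    (F : MvPolynomial (Fin n) R) :
    extend R (lam ∘ₗ LinearMap.mulLeft ℂ f) F = extend R lam (map (algebraMap ℂ R) f * F) := by
  induction F using C_mul_map_monomial_induction with
  | h c g =>
    rw [mul_left_comm, ← map_mul, extend_C_mul, extend_map, extend_C_mul, extend_map]
    rfl
  | hadd F G hF hG => rw [mul_add, map_add, map_add, hF, hG]

/-- The representation of the residue is known for complex polynomials only, whereas det B(s, z) has
coefficients in ℂ[z]. Both sides are linear over `R`, so the formula extends. -/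
theorem sum_applyPoly_eq_extend {m : ℕ} {w : Fin m → Fin n → ℂ} {Q : Fin m → MvPolynomial (Fin n) ℂ}
    {lam : MvPolynomial (Fin n) ℂ →ₗ[ℂ] ℂ} (h : ∀ g, lam g = ∑ j, applyPoly (Q j) (w j) g)
    (F : MvPolynomial (Fin n) R) : ∑ j, applyPoly (Q j) (w j) F = extend R lam F := by
  simp only [applyPoly_eq_sum _ _ _ subset_rfl] at h ⊢
  induction F using C_mul_map_monomial_induction with
  | h c g =>
    rw [extend_C_mul, extend_map, h, ← smul_eq_C_mul]
    simp only [map_sum, Finset.mul_sum, map_smul (taylorCoeff _ _), taylorCoeff_map, smul_eq_mul,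
      map_mul, Algebra.smul_def (A := R)]
    refine Finset.sum_congr rfl fun j _ => Finset.sum_congr rfl fun l _ => ?_
    ring
  | hadd F G hF hG =>
    simp only [map_add, smul_add, Finset.sum_add_distrib, hF, hG]

end Operators

/-! ### The residue as a linear form -/

section Residue

variable {n : ℕ}

theorem prod_aeval_X {R : Type*} [CommRing R] (r : Fin n → Polynomial R) :
    ∏ j, Polynomial.aeval (X j : MvPolynomial (Fin n) R) (r j) =
      ∑ f ∈ Fintype.piFinset fun j => (r j).support,
        monomial (Finsupp.equivFunOnFinite.symm f) (∏ j, (r j).coeff (f j)) := by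
  have h : ∀ j, Polynomial.aeval (X j : MvPolynomial (Fin n) R) (r j) =
      ∑ a ∈ (r j).support, monomial (Finsupp.single j a) ((r j).coeff a) := by
    intro j
    rw [Polynomial.aeval_def, Polynomial.eval₂_eq_sum, Polynomial.sum_def]
    refine Finset.sum_congr rfl fun a _ => ?_
    rw [MvPolynomial.algebraMap_eq, X_pow_eq_monomial, C_mul_monomial, mul_one]
  simp only [h]
  rw [Finset.prod_univ_sum]
  refine Finset.sum_congr rfl fun f _ => ?_
  rw [← Finsupp.univ_sum_single (Finsupp.equivFunOnFinite.symm f), monomial_sum_index, map_prod,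
    ← Finset.prod_mul_distrib]
  refine Finset.prod_congr rfl fun j _ => ?_
  rw [C_mul_monomial, mul_one]
  rfl

theorem extend_prod_aeval_X {R : Type*} [CommRing R] [Algebra ℂ R]
    {lam : MvPolynomial (Fin n) ℂ →ₗ[ℂ] ℂ} {ν : Fin n → ℕ → ℂ}
    (hlam : ∀ l, lam (monomial l 1) = ∏ j, ν j (l j)) (r : Fin n → Polynomial R) :
    extend R lam (∏ j, Polynomial.aeval (X j : MvPolynomial (Fin n) R) (r j)) =
      ∏ j, (r j).sum fun a c => c * algebraMap ℂ R (ν j a) := by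
  simp only [Polynomial.sum_def]
  rw [prod_aeval_X, map_sum, Finset.prod_univ_sum]
  refine Finset.sum_congr rfl fun f _ => ?_
  rw [extend_monomial, hlam, map_prod, ← Finset.prod_mul_distrib]
  rfl

theorem extend_complex (lam : MvPolynomial (Fin n) ℂ →ₗ[ℂ] ℂ) (f : MvPolynomial (Fin n) ℂ) :
    extend ℂ lam f = lam f := by
  have := extend_map (R := ℂ) lam f
  rwa [Algebra.algebraMap_self, MvPolynomial.map_id] at this

theorem coeff_prod_aeval_X (D : Fin n →₀ ℕ) (r : Fin n → Polynomial ℂ) :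
    coeff D (∏ j, Polynomial.aeval (X j : MvPolynomial (Fin n) ℂ) (r j)) =
      ∏ j, (r j).coeff (D j) := by
  rw [← lcoeff_apply, ← extend_complex, extend_prod_aeval_X
    (ν := fun j a => if a = D j then 1 else 0)]
  · refine Finset.prod_congr rfl fun j _ => ?_
    simp [Polynomial.sum_def]
    tauto
  · intro l
    rw [lcoeff_apply, coeff_monomial, Finset.prod_ite_zero]
    simp [DFunLike.ext_iff]

/-- The coefficient of `X ^ (deg q - 1)` in the remainder of the division by `q`. -/
def remainderCoeff (q : Polynomial ℂ) : Polynomial ℂ →ₗ[ℂ] ℂ :=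
  Polynomial.lcoeff ℂ (q.natDegree - 1) ∘ₗ Polynomial.modByMonicHom q

theorem remainderCoeff_mul {q : Polynomial ℂ} (hq : q.Monic) (f : Polynomial ℂ) :
    remainderCoeff q (q * f) = 0 := by
  simp [remainderCoeff, (Polynomial.modByMonic_eq_zero_iff_dvd hq).mpr (dvd_mul_right q f)]

theorem remainderCoeff_X_pow {q : Polynomial ℂ} (hq : q.Monic) {a : ℕ} (ha : a < q.natDegree) :
    remainderCoeff q (Polynomial.X ^ a) = if a = q.natDegree - 1 then 1 else 0 := by
  have : (Polynomial.X ^ a : Polynomial ℂ) %ₘ q = Polynomial.X ^ a := by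
    rw [Polynomial.modByMonic_eq_self_iff hq, Polynomial.degree_X_pow,
      Polynomial.degree_eq_natDegree hq.ne_zero]
    exact_mod_cast ha
  simp [remainderCoeff, this, Polynomial.coeff_X_pow, eq_comm]

/-- The residue with respect to the polynomials `q₁(s₁), …, qₙ(sₙ)`. -/
def univariateResidue (q : Fin n → Polynomial ℂ) : MvPolynomial (Fin n) ℂ →ₗ[ℂ] ℂ :=
  (basisMonomials (Fin n) ℂ).constr ℂ fun l => ∏ j, remainderCoeff (q j) (Polynomial.X ^ l j)

theorem univariateResidue_monomial (q : Fin n → Polynomial ℂ) (l : Fin n →₀ ℕ) :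
    univariateResidue q (monomial l 1) = ∏ j, remainderCoeff (q j) (Polynomial.X ^ l j) := by
  have h := (basisMonomials (Fin n) ℂ).constr_basis ℂ
    (fun l => ∏ j, remainderCoeff (q j) (Polynomial.X ^ l j)) l
  rwa [coe_basisMonomials] at h

theorem univariateResidue_mul {q : Fin n → Polynomial ℂ} {k : Fin n} (hq : (q k).Monic)
    (g : MvPolynomial (Fin n) ℂ) :
    univariateResidue q (Polynomial.aeval (X k : MvPolynomial (Fin n) ℂ) (q k) * g) = 0 := by
  induction g using MvPolynomial.induction_on' with
  | add f g hf hg => rw [mul_add, map_add, hf, hg, add_zero]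
  | monomial l c =>
    -- On a product of univariate polynomials the form factors; the factor of index k is the
    -- remainder coefficient of a multiple of `q k`, which is zero.
    have h : Polynomial.aeval (X k : MvPolynomial (Fin n) ℂ) (q k) * monomial l c =
        c • ∏ j, Polynomial.aeval (X j : MvPolynomial (Fin n) ℂ)
          ((if j = k then q k else 1) * Polynomial.X ^ l j) := by
      simp only [map_mul, Finset.prod_mul_distrib, apply_ite (Polynomial.aeval _), map_one,
        map_pow, Polynomial.aeval_X, Finset.prod_ite_eq', Finset.mem_univ, if_true]
      rw [monomial_eq, Finsupp.prod_fintype _ _ fun _ => pow_zero _]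
      rw [smul_eq_C_mul, mul_left_comm]
    rw [h, map_smul, ← extend_complex, extend_prod_aeval_X
      (ν := fun j a => remainderCoeff (q j) (Polynomial.X ^ a)) (univariateResidue_monomial q),
      Finset.prod_eq_zero (Finset.mem_univ k), smul_zero]
    rw [if_pos rfl, ← remainderCoeff_mul hq (Polynomial.X ^ l k)]
    conv_rhs => rw [Polynomial.as_sum_support_C_mul_X_pow (q k * Polynomial.X ^ l k), map_sum]
    simp [Polynomial.sum_def, ← Polynomial.smul_eq_C_mul]

/-- The residue with respect to `p₁, …, pₙ` computed from `q` and `A`, as a linear form. -/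
def residueForm (q : Fin n → Polynomial ℂ) (A : Matrix (Fin n) (Fin n) (MvPolynomial (Fin n) ℂ)) :
    MvPolynomial (Fin n) ℂ →ₗ[ℂ] ℂ :=
  univariateResidue q ∘ₗ LinearMap.mulLeft ℂ A.det

theorem residueVia_eq (q : Fin n → Polynomial ℂ)
    (A : Matrix (Fin n) (Fin n) (MvPolynomial (Fin n) ℂ)) (g : MvPolynomial (Fin n) ℂ) :
    residueVia q A g = residueForm q A g := by
  rw [residueForm, LinearMap.comp_apply, LinearMap.mulLeft_apply, mul_comm, residueVia,
    euclidRemainder, coeff_sum]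
  conv_rhs => rw [as_sum (g * A.det), map_sum]
  refine Finset.sum_congr rfl fun l _ => ?_
  rw [coeff_C_mul, coeff_prod_aeval_X, show monomial l (coeff l (g * A.det)) =
      coeff l (g * A.det) • monomial l 1 by rw [smul_monomial, smul_eq_mul, mul_one], map_smul,
     univariateResidue_monomial]
  simp [remainderCoeff]

/-- Since adj(A) A = det A, the product det A · pₖ is a combination of the qⱼ(sⱼ), which the
univariate residue kills. -/
theorem residueForm_mul {p : Fin n → MvPolynomial (Fin n) ℂ} {q : Fin n → Polynomial ℂ}
    {A : Matrix (Fin n) (Fin n) (MvPolynomial (Fin n) ℂ)} (hA : IsUnivariateReduction p q A)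
    (k : Fin n) (g : MvPolynomial (Fin n) ℂ) : residueForm q A (p k * g) = 0 := by
  have h : A.det * p k = ∑ j, A.adjugate k j *
      Polynomial.aeval (X j : MvPolynomial (Fin n) ℂ) (q j) := by
    have h1 : A.mulVec p = fun j => Polynomial.aeval (X j : MvPolynomial (Fin n) ℂ) (q j) :=
      funext fun j => (hA.2 j).symm
    have h2 := congrFun (congrArg (A.adjugate.mulVec) h1) k
    rw [Matrix.mulVec_mulVec, Matrix.adjugate_mul, Matrix.smul_mulVec, Matrix.one_mulVec] at h2
    exact h2
  rw [residueForm, LinearMap.comp_apply, LinearMap.mulLeft_apply, ← mul_assoc, h, Finset.sum_mul,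
    map_sum]
  refine Finset.sum_eq_zero fun j _ => ?_
  rw [mul_comm (A.adjugate k j), mul_assoc, univariateResidue_mul (hA.1 j)]

theorem residueForm_eq_zero {p : Fin n → MvPolynomial (Fin n) ℂ} {q : Fin n → Polynomial ℂ}
    {A : Matrix (Fin n) (Fin n) (MvPolynomial (Fin n) ℂ)} (hA : IsUnivariateReduction p q A)
    {f : MvPolynomial (Fin n) ℂ} (hf : f ∈ polyIdeal p) : residueForm q A f = 0 := by
  rw [polyIdeal, Ideal.mem_span_range_iff_exists_fun] at hf
  obtain ⟨c, rfl⟩ := hf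
  rw [map_sum]
  exact Finset.sum_eq_zero fun k _ => by rw [mul_comm, residueForm_mul hA]

end Residue

/-! ### Divisibility by `s - a` -/

section PointIdeal

variable {n : ℕ} {R : Type*} [CommRing R]

/-- The ideal `(s₁ - a₁, …, sₙ - aₙ)`. -/
def pointIdeal (a : Fin n → R) : Ideal (MvPolynomial (Fin n) R) :=
  Ideal.span (Set.range fun i => X i - C (a i))

theorem X_sub_C_mem_pointIdeal (a : Fin n → R) (i : Fin n) : X i - C (a i) ∈ pointIdeal a :=
  Ideal.subset_span ⟨i, rfl⟩

theorem sub_C_eval_mem_pointIdeal (a : Fin n → R) (f : MvPolynomial (Fin n) R) :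
    f - C (eval a f) ∈ pointIdeal a := by
  induction f using MvPolynomial.induction_on with
  | C c => simp
  | add f g hf hg =>
    have := add_mem hf hg
    rwa [show f - C (eval a f) + (g - C (eval a g)) = f + g - C (eval a (f + g)) by
      rw [map_add, map_add]; ring] at this
  | mul_X f i hf =>
    have := add_mem (Ideal.mul_mem_right (X i) _ hf)
      (Ideal.mul_mem_left _ (C (eval a f)) (X_sub_C_mem_pointIdeal a i))
    rwa [show (f - C (eval a f)) * X i + C (eval a f) * (X i - C (a i)) =
      f * X i - C (eval a (f * X i)) by rw [map_mul, map_mul, eval_X]; ring] at this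

/-- The substitution `sᵢ ↦ c`. -/
def specialize (i : Fin n) (c : R) : MvPolynomial (Fin n) R →ₐ[R] MvPolynomial (Fin n) R :=
  aeval (Function.update X i (C c))

theorem X_sub_C_dvd_sub_specialize (i : Fin n) (c : R) (f : MvPolynomial (Fin n) R) :
    X i - C c ∣ f - specialize i c f := by
  induction f using MvPolynomial.induction_on with
  | C a => simp [specialize]
  | add f g hf hg =>
    rw [map_add, add_sub_add_comm]
    exact dvd_add hf hg
  | mul_X f j hf =>
    have hj : X i - C c ∣ X j - specialize i c (X j) := by
      by_cases h : j = i
      · subst h; simp [specialize]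
      · simp [specialize, h]
    rw [map_mul, show f * X j - specialize i c f * specialize i c (X j) =
      (f - specialize i c f) * X j + specialize i c f * (X j - specialize i c (X j)) by ring]
    exact dvd_add (hf.mul_right _) (hj.mul_left _)

/-- Modulo elements free of sᵢ, the factor sᵢ - c is not a zero divisor: setting sᵢ = c in a
relation and subtracting leaves coefficients divisible by sᵢ - c, which can then be cancelled. -/
theorem mem_span_of_X_sub_C_mul_mem {ι : Type*} [Fintype ι] {i : Fin n} {c : R}
    {y : ι → MvPolynomial (Fin n) R} (hy : ∀ k, specialize i c (y k) = y k)
    {f : MvPolynomial (Fin n) R} (hf : (X i - C c) * f ∈ Ideal.span (Set.range y)) :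
    f ∈ Ideal.span (Set.range y) := by
  rw [Ideal.mem_span_range_iff_exists_fun] at hf ⊢
  obtain ⟨g, hg⟩ := hf
  choose h hh using fun k => X_sub_C_dvd_sub_specialize i c (g k)
  refine ⟨h, (sub_eq_zero.mp (X_sub_C_mul_eq_zero (i := i) (c := c) ?_)).symm⟩
  have h0 := congrArg (specialize i c) hg
  rw [map_mul, map_sub, show specialize i c (X i) = C c by simp [specialize],
    show specialize i c (C c) = C c by simp [specialize], sub_self, zero_mul, map_sum] at h0
  simp only [map_mul, hy] at h0
  rw [mul_sub, ← hg, Finset.mul_sum]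
  simp only [← mul_assoc, ← hh, sub_mul, Finset.sum_sub_distrib, h0, sub_zero, sub_self]

end PointIdeal

/-! ### Duality -/

section Duality

variable {n : ℕ} {R : Type*} [CommRing R] [Algebra ℂ R]

theorem specialize_aeval_X {i k : Fin n} (h : k ≠ i) (c : R) (q : Polynomial ℂ) :
    specialize i c (Polynomial.aeval (X k : MvPolynomial (Fin n) R) q) =
      Polynomial.aeval (X k : MvPolynomial (Fin n) R) q := by
  have := Polynomial.aeval_algHom_apply ((specialize i c).restrictScalars ℂ)
    (X k : MvPolynomial (Fin n) R) q
  rw [AlgHom.restrictScalars_apply, AlgHom.restrictScalars_apply] at this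
  rw [← this]
  simp [specialize, h]

/-- The rows of N are replaced by those of M one at a time; by linearity in a row, each replacement
changes the determinant by that of a matrix with one row orthogonal to s - z. -/
theorem det_sub_det_mem {q : Fin n → Polynomial ℂ} {z : Fin n → R}
    {M N : Matrix (Fin n) (Fin n) (MvPolynomial (Fin n) R)}
    (hM : ∀ j, ∑ k, M j k * (X k - C (z k)) = Polynomial.aeval (X j) (q j))
    (hN : ∀ j, ∑ k, N j k * (X k - C (z k)) = Polynomial.aeval (X j) (q j)) :
    M.det - N.det ∈ Ideal.span (Set.range fun j =>
      (Polynomial.aeval (X j) (q j) : MvPolynomial (Fin n) R)) := by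
  have key : ∀ S : Finset (Fin n),
      (Matrix.of fun j => if j ∈ S then M j else N j).det - N.det ∈ Ideal.span (Set.range fun j =>
        (Polynomial.aeval (X j) (q j) : MvPolynomial (Fin n) R)) := by
    intro S
    induction S using Finset.induction_on with
    | empty =>
      rw [show (Matrix.of fun j => if j ∈ (∅ : Finset (Fin n)) then M j else N j) = N by
        ext; simp, sub_self]
      exact zero_mem _
    | insert i S hi ih =>
      set E : Matrix (Fin n) (Fin n) (MvPolynomial (Fin n) R) :=
        Matrix.of fun j => if j ∈ S then M j else N j with hE
      have hE' : ∀ j, ∑ k, E j k * (X k - C (z k)) = Polynomial.aeval (X j) (q j) := by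
        intro j
        by_cases hj : j ∈ S
        · simpa [hE, hj] using hM j
        · simpa [hE, hj] using hN j
      have h1 : (Matrix.of fun j => if j ∈ insert i S then M j else N j) =
          E.updateRow i ((M i - N i) + N i) := by
        ext j k : 2
        by_cases hj : j = i
        · subst hj; simp
        · simp [hE, hj, Finset.mem_insert]
      have h2 : E.updateRow i (N i) = E := by
        conv_rhs => rw [← Matrix.updateRow_eq_self E i]
        congr 1
        exact (if_neg hi).symm
      rw [h1, Matrix.det_updateRow_add, h2, add_sub_assoc]
      refine add_mem ?_ ih
      -- Row i of F annihilates s - z, so Cramer's rule puts (sᵢ - zᵢ) det F in the ideal of the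
      -- qⱼ(sⱼ) with j ≠ i. These do not involve sᵢ, hence sᵢ - zᵢ can be cancelled.
      set F := E.updateRow i (M i - N i) with hF
      have hv : F.mulVec (fun k => X k - C (z k)) =
          fun j => if j = i then 0 else Polynomial.aeval (X j) (q j) := by
        ext1 j
        by_cases hj : j = i
        · subst hj
          simp only [Matrix.mulVec, dotProduct, hF, Matrix.updateRow_self, Pi.sub_apply, sub_mul,
            Finset.sum_sub_distrib, hM, hN, sub_self, if_true]
        · simp only [Matrix.mulVec, dotProduct, hF, Matrix.updateRow_ne hj, hE', hj, if_false]
      have hc := congrFun (congrArg F.adjugate.mulVec hv) i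
      rw [Matrix.mulVec_mulVec, Matrix.adjugate_mul, Matrix.smul_mulVec, Matrix.one_mulVec,
        Pi.smul_apply, smul_eq_mul, mul_comm] at hc
      have hmem : F.det ∈ Ideal.span (Set.range fun j =>
          if j = i then (0 : MvPolynomial (Fin n) R) else Polynomial.aeval (X j) (q j)) := by
        refine mem_span_of_X_sub_C_mul_mem (i := i) (c := z i) (fun k => ?_) ?_
        · by_cases hk : k = i
          · simp [hk]
          · simp [hk, specialize_aeval_X hk]
        · rw [hc, Matrix.mulVec, dotProduct]
          exact Ideal.sum_mem _ fun k _ =>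
            Ideal.mul_mem_left _ _ (Ideal.subset_span ⟨k, rfl⟩)
      refine Ideal.span_le.mpr ?_ hmem
      rintro _ ⟨j, rfl⟩
      by_cases hj : j = i
      · simp [hj]
      · simp only [if_neg hj, SetLike.mem_coe]
        exact Ideal.subset_span ⟨j, rfl⟩
  have := key Finset.univ
  rwa [show (Matrix.of fun j => if j ∈ (Finset.univ : Finset (Fin n)) then M j else N j) = M by
        ext; simp] at this

theorem map_aeval_X (i : Fin n) (q : Polynomial ℂ) :
    map (algebraMap ℂ R) (Polynomial.aeval (X i) q) =
      Polynomial.aeval (X i : MvPolynomial (Fin n) R) q := by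
  have := Polynomial.aeval_algHom_apply (mapAlgHom (σ := Fin n) (Algebra.ofId ℂ R))
    (X i : MvPolynomial (Fin n) ℂ) q
  simp only [mapAlgHom_apply, Algebra.ofId] at this
  refine (this.symm.trans ?_)
  congr 2
  exact map_X _ _

/-- The residue of the determinant of a Bézoutian of `q₁(s₁), …, qₙ(sₙ)` at a common zero is `1`. -/
theorem extend_univariateResidue_det [Nontrivial R] {q : Fin n → Polynomial ℂ}
    (hq : ∀ j, (q j).Monic) {z : Fin n → R}
    (hz : ∀ j, Polynomial.aeval (z j) (q j) = 0)
    {M : Matrix (Fin n) (Fin n) (MvPolynomial (Fin n) R)}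
    (hM : ∀ j, ∑ k, M j k * (X k - C (z k)) = Polynomial.aeval (X j) (q j)) :
    extend R (univariateResidue q) M.det = 1 := by
  have hG : ∀ j, ∃ G : Polynomial R, (q j).map (algebraMap ℂ R) =
      (Polynomial.X - Polynomial.C (z j)) * G := fun j =>
    Polynomial.dvd_iff_isRoot.mpr (by
      rw [Polynomial.IsRoot, Polynomial.eval_map_algebraMap, hz])
  choose G hG using hG
  have hGm : ∀ j, (G j).Monic := fun j =>
    Polynomial.Monic.of_mul_monic_left (Polynomial.monic_X_sub_C (z j))
      (hG j ▸ (hq j).map _)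
  have hGd : ∀ j, (G j).natDegree + 1 = (q j).natDegree := fun j => by
    have := congrArg Polynomial.natDegree (hG j)
    rw [(hq j).natDegree_map, (Polynomial.monic_X_sub_C (z j)).natDegree_mul (hGm j),
      Polynomial.natDegree_X_sub_C] at this
    omega
  -- The diagonal matrix of the quotients Gⱼ = qⱼ/(X - zⱼ) satisfies the same relations as M, so its
  -- determinant has the same residue.
  have hN : ∀ j, ∑ k, (Matrix.diagonal fun j =>
      Polynomial.aeval (X j : MvPolynomial (Fin n) R) (G j)) j k * (X k - C (z k)) =
        Polynomial.aeval (X j) (q j) := by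
    intro j
    rw [Finset.sum_eq_single j (fun k _ hk => by rw [Matrix.diagonal_apply_ne' _ hk, zero_mul])
      (fun h => absurd (Finset.mem_univ j) h), Matrix.diagonal_apply_eq]
    rw [← Polynomial.aeval_map_algebraMap R (X j) (q j), hG, map_mul, map_sub, Polynomial.aeval_X,
      Polynomial.aeval_C, mul_comm]
    rfl
  have hker : ∀ F ∈ Ideal.span (Set.range fun j =>
      (Polynomial.aeval (X j) (q j) : MvPolynomial (Fin n) R)),
      extend R (univariateResidue q) F = 0 := by
    intro F hF
    rw [Ideal.mem_span_range_iff_exists_fun] at hF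
    obtain ⟨c, rfl⟩ := hF
    rw [map_sum]
    refine Finset.sum_eq_zero fun k _ => ?_
    rw [mul_comm, ← map_aeval_X]
    exact extend_eq_zero_of_mul _ (univariateResidue_mul (hq k)) _
  have h := hker _ (det_sub_det_mem hM hN)
  rw [map_sub, sub_eq_zero] at h
  rw [h, Matrix.det_diagonal, extend_prod_aeval_X
    (ν := fun j a => remainderCoeff (q j) (Polynomial.X ^ a)) (univariateResidue_monomial q)]
  -- Gⱼ is monic of degree deg qⱼ - 1, exactly the exponent that the residue reads; lower terms do
  -- not contribute.
  refine Finset.prod_eq_one fun j _ => ?_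
  rw [Polynomial.sum_def, Finset.sum_eq_single (G j).natDegree]
  · rw [remainderCoeff_X_pow (hq j) (by have := hGd j; omega), if_pos (by have := hGd j; omega),
      map_one, mul_one]
    exact hGm j
  · intro a ha hne
    have hle := Polynomial.le_natDegree_of_mem_supp a ha
    rw [remainderCoeff_X_pow (hq j) (by have := hGd j; omega),
      if_neg (by have := hGd j; omega), map_zero, mul_zero]
  · intro h0
    rw [Polynomial.notMem_support_iff.mp h0, zero_mul]

variable {p : Fin n → MvPolynomial (Fin n) ℂ} {q : Fin n → Polynomial ℂ}
  {A : Matrix (Fin n) (Fin n) (MvPolynomial (Fin n) ℂ)}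
  {B : Matrix (Fin n) (Fin n) (MvPolynomial (Fin n) (MvPolynomial (Fin n) ℂ))}

theorem mem_polyIdeal (p : Fin n → MvPolynomial (Fin n) ℂ) (j : Fin n) : p j ∈ polyIdeal p :=
  Ideal.subset_span ⟨j, rfl⟩

theorem map_map_C (φ : MvPolynomial (Fin n) ℂ →ₐ[ℂ] R) (f : MvPolynomial (Fin n) ℂ) :
    map (φ : MvPolynomial (Fin n) ℂ →+* R) (map C f) = map (algebraMap ℂ R) f := by
  rw [MvPolynomial.map_map]
  congr 2
  ext1 c
  exact φ.commutes c

theorem sum_map_mul (φ : MvPolynomial (Fin n) ℂ →ₐ[ℂ] R) (hφ : ∀ j, φ (p j) = 0)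
    (hB : IsBezoutian p B) (j : Fin n) :
    ∑ k, map (φ : MvPolynomial (Fin n) ℂ →+* R) (B j k) * (X k - C (φ (X k))) =
      map (algebraMap ℂ R) (p j) := by
  have h := congrArg (MvPolynomial.map (σ := Fin n) (φ : MvPolynomial (Fin n) ℂ →+* R)) (hB j)
  simp only [map_sub, map_map_C, map_C, RingHom.coe_coe, hφ, map_zero, sub_zero, map_sum, map_mul,
    map_X] at h
  exact h.symm

theorem aeval_map_X_eq_zero (φ : MvPolynomial (Fin n) ℂ →ₐ[ℂ] R) (hφ : ∀ j, φ (p j) = 0)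
    (hA : IsUnivariateReduction p q A) (j : Fin n) : Polynomial.aeval (φ (X j)) (q j) = 0 := by
  rw [Polynomial.aeval_algHom_apply, hA.2 j, map_sum]
  exact Finset.sum_eq_zero fun k _ => by rw [map_mul, hφ, mul_zero]

/-- The factor det A in the residue combines with det B into det(AB), and AB is a matrix as in
`extend_univariateResidue_det`. -/
theorem map_extend_residueForm_det [Nontrivial R] (φ : MvPolynomial (Fin n) ℂ →ₐ[ℂ] R)
    (hφ : ∀ j, φ (p j) = 0) (hA : IsUnivariateReduction p q A) (hB : IsBezoutian p B) :
    φ (extend _ (residueForm q A) B.det) = 1 := by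
  rw [map_extend, residueForm, extend_mulLeft, RingHom.map_det, RingHom.map_det, ← Matrix.det_mul]
  refine extend_univariateResidue_det hA.1 (aeval_map_X_eq_zero φ hφ hA) fun j => ?_
  simp only [Matrix.mul_apply, Finset.sum_mul]
  rw [Finset.sum_comm]
  simp only [mul_assoc, ← Finset.mul_sum]
  rw [← map_aeval_X, hA.2 j, map_sum]
  refine Finset.sum_congr rfl fun k _ => ?_
  rw [map_mul, ← sum_map_mul φ hφ hB k]
  rfl

theorem map_extend_residueForm_mul_det [Nontrivial R] (φ : MvPolynomial (Fin n) ℂ →ₐ[ℂ] R)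
    (hφ : ∀ j, φ (p j) = 0) (hA : IsUnivariateReduction p q A) (hB : IsBezoutian p B)
    (f : MvPolynomial (Fin n) ℂ) :
    φ (extend _ (residueForm q A) (map C f * B.det)) = φ f := by
  set z : Fin n → R := fun k => φ (X k) with hz
  set M := (MvPolynomial.map (σ := Fin n) (φ : MvPolynomial (Fin n) ℂ →+* R)).mapMatrix B with hM
  -- (sₖ - zₖ) det M is a combination of the pⱼ(s) by Cramer's rule, hence has residue zero even
  -- after multiplication. So f(s) may be replaced by f(z), which leaves the residue.
  have hker : ∀ F ∈ pointIdeal z, extend R (residueForm q A) (F * M.det) = 0 := by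
    intro F hF
    rw [pointIdeal, Ideal.mem_span_range_iff_exists_fun] at hF
    obtain ⟨c, rfl⟩ := hF
    rw [Finset.sum_mul, map_sum]
    refine Finset.sum_eq_zero fun k _ => ?_
    have h1 : M.mulVec (fun k => X k - C (z k)) = fun j => map (algebraMap ℂ R) (p j) :=
      funext fun j => sum_map_mul φ hφ hB j
    have h2 : M.det * (X k - C (z k)) = ∑ j, M.adjugate k j * map (algebraMap ℂ R) (p j) := by
      have h3 := congrFun (congrArg M.adjugate.mulVec h1) k
      rw [Matrix.mulVec_mulVec, Matrix.adjugate_mul, Matrix.smul_mulVec, Matrix.one_mulVec] at h3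
      exact h3
    rw [mul_assoc, mul_comm _ M.det, h2, Finset.mul_sum, map_sum]
    refine Finset.sum_eq_zero fun j _ => ?_
    rw [← mul_assoc, mul_comm]
    exact extend_eq_zero_of_mul _ (residueForm_mul hA j) _
  have hev : eval z (map (algebraMap ℂ R) f) = φ f := by
    rw [eval_map, ← aeval_def]
    exact DFunLike.congr_fun (aeval_unique φ).symm f
  have h0 := hker _ (sub_C_eval_mem_pointIdeal z (map (algebraMap ℂ R) f))
  rw [sub_mul, map_sub, sub_eq_zero, hev, extend_C_mul, hM, ← RingHom.map_det, ← map_extend,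
    map_extend_residueForm_det φ hφ hA hB, mul_one] at h0
  rw [map_extend, map_mul, map_map_C, h0]

theorem mk_mem_polyIdeal_eq_zero (p : Fin n → MvPolynomial (Fin n) ℂ) (j : Fin n) :
    Ideal.Quotient.mkₐ ℂ (polyIdeal p) (p j) = 0 :=
  Ideal.Quotient.eq_zero_iff_mem.mpr (mem_polyIdeal p j)

/-- The residue of the determinant of a Bézoutian matrix is congruent to `1`. -/
theorem extend_residueForm_det (hp : polyIdeal p ≠ ⊤) (hA : IsUnivariateReduction p q A)
    (hB : IsBezoutian p B) :
    Ideal.Quotient.mk (polyIdeal p) (extend _ (residueForm q A) B.det) = 1 :=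
  have := Ideal.Quotient.nontrivial_iff.mpr hp
  map_extend_residueForm_det (Ideal.Quotient.mkₐ ℂ (polyIdeal p)) (mk_mem_polyIdeal_eq_zero p) hA hB

/-- The residue of `f(s) det B(s, z)` is congruent to `f(z)`. -/
theorem extend_residueForm_mul_det (hp : polyIdeal p ≠ ⊤) (hA : IsUnivariateReduction p q A)
    (hB : IsBezoutian p B) (f : MvPolynomial (Fin n) ℂ) :
    Ideal.Quotient.mk (polyIdeal p) (extend _ (residueForm q A) (map C f * B.det)) =
      Ideal.Quotient.mk (polyIdeal p) f :=
  have := Ideal.Quotient.nontrivial_iff.mpr hp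
  map_extend_residueForm_mul_det (Ideal.Quotient.mkₐ ℂ (polyIdeal p)) (mk_mem_polyIdeal_eq_zero p)
    hA hB f

/-- The exchange of the variables `s` and `z`. -/
def swapVars : MvPolynomial (Fin n) (MvPolynomial (Fin n) ℂ) →+*
    MvPolynomial (Fin n) (MvPolynomial (Fin n) ℂ) :=
  eval₂Hom (map C) fun k => C (X k)

theorem swapVars_C (f : MvPolynomial (Fin n) ℂ) : swapVars (C f) = map C f := by
  simp [swapVars]

theorem swapVars_X (k : Fin n) : swapVars (X k : MvPolynomial (Fin n) (MvPolynomial (Fin n) ℂ)) =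
    C (X k) := by
  simp [swapVars]

theorem swapVars_map_C (f : MvPolynomial (Fin n) ℂ) : swapVars (map C f) = C f := by
  induction f using MvPolynomial.induction_on with
  | C c => simp [swapVars_C]
  | add f g hf hg => simp only [map_add, hf, hg]
  | mul_X f i hf => simp only [map_mul, hf, map_X, swapVars_X]

theorem IsBezoutian.swapVars (hB : IsBezoutian p B) :
    IsBezoutian p (ResidueInterpolation.swapVars.mapMatrix B) := by
  intro j
  have h := congrArg (fun F => -ResidueInterpolation.swapVars F) (hB j)
  simp only [map_sub, map_sum, map_mul, swapVars_C, swapVars_X, swapVars_map_C, map_X,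
    neg_sub] at h
  rw [h, ← Finset.sum_neg_distrib]
  refine Finset.sum_congr rfl fun k _ => ?_
  rw [RingHom.mapMatrix_apply, Matrix.map_apply]
  ring

/-- Fubini: forms acting on separate sets of variables commute, as is clear on products c(z) g(s).
-/
theorem extend_swapVars (lam mu : MvPolynomial (Fin n) ℂ →ₗ[ℂ] ℂ)
    (F : MvPolynomial (Fin n) (MvPolynomial (Fin n) ℂ)) :
    mu (extend _ lam F) = lam (extend _ mu (swapVars F)) := by
  induction F using C_mul_map_monomial_induction with
  | h c g =>
    rw [algebraMap_eq, map_mul swapVars, swapVars_C, swapVars_map_C, mul_comm (map C c)]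
    rw [← algebraMap_eq (R := ℂ) (σ := Fin n)]
    rw [extend_C_mul, extend_map, extend_C_mul, extend_map, mul_comm c, mul_comm g,
      ← Algebra.smul_def, ← Algebra.smul_def, map_smul, map_smul, smul_eq_mul, smul_eq_mul,
      mul_comm]
  | hadd F G hF hG => simp only [map_add, hF, hG]

/-- The residue does not depend on the choice of `q` and `A`. -/
theorem residueForm_unique (hp : polyIdeal p ≠ ⊤) (hB : IsBezoutian p B)
    (hA : IsUnivariateReduction p q A) {q' : Fin n → Polynomial ℂ}
    {A' : Matrix (Fin n) (Fin n) (MvPolynomial (Fin n) ℂ)} (hA' : IsUnivariateReduction p q' A') :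
    residueForm q A = residueForm q' A' := by
  have hcongr : ∀ {q : Fin n → Polynomial ℂ} {A : Matrix (Fin n) (Fin n) (MvPolynomial (Fin n) ℂ)},
      IsUnivariateReduction p q A → ∀ {f g : MvPolynomial (Fin n) ℂ},
      Ideal.Quotient.mk (polyIdeal p) f = Ideal.Quotient.mk (polyIdeal p) g →
      residueForm q A f = residueForm q A g := by
    intro q A hA f g h
    rw [← sub_eq_zero, ← map_sub]
    exact residueForm_eq_zero hA (Ideal.Quotient.eq.mp h)
  ext1 g
  refine LinearMap.ext fun c => ?_
  generalize hf : (monomial g) c = f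
  show residueForm q A (monomial g c) = residueForm q' A' (monomial g c)
  -- With Res and Res' the two residues: Res'(f) = Res'_z Res_s[f(s) det B] = Res_s[f(s) Res'_z[det
  -- B]] = Res(f), the last step because the exchange of s and z preserves Bézoutian matrices.
  rw [hf, ← hcongr hA' (extend_residueForm_mul_det hp hA hB f), extend_swapVars, map_mul,
    swapVars_map_C, extend_C_mul, RingHom.map_det]
  refine hcongr hA ?_
  rw [map_mul, extend_residueForm_det hp hA' hB.swapVars, mul_one]

/-- Bézoutian matrices exist. -/
theorem exists_isBezoutian (p : Fin n → MvPolynomial (Fin n) ℂ) : ∃ B, IsBezoutian p B := by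
  have h : ∀ j, ∃ c : Fin n → MvPolynomial (Fin n) (MvPolynomial (Fin n) ℂ),
      ∑ k, c k * (X k - C (X k)) = map C (p j) - C (p j) := by
    intro j
    rw [← Ideal.mem_span_range_iff_exists_fun]
    have := sub_C_eval_mem_pointIdeal (fun k => X k) (map C (p j))
    rwa [eval_map, show eval₂ C (fun k => X k) (p j) = p j from eval₂_eta (p j)] at this
  choose B hB using h
  exact ⟨Matrix.of B, fun j => (hB j).symm⟩

end Duality

/-! ### Powers of the maximal ideals of points -/

section Points

variable {n : ℕ}

theorem mem_pointIdeal_iff {x : Fin n → ℂ} {f : MvPolynomial (Fin n) ℂ} :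
    f ∈ pointIdeal x ↔ eval x f = 0 := by
  constructor
  · intro h
    have hle : pointIdeal x ≤ RingHom.ker (eval x) := by
      rw [pointIdeal, Ideal.span_le]
      rintro _ ⟨i, rfl⟩
      simp
    exact hle h
  · intro h
    have := sub_C_eval_mem_pointIdeal x f
    rwa [h, C_0, sub_zero] at this

theorem isCoprime_pointIdeal_pow {x y : Fin n → ℂ} (h : x ≠ y) (N : ℕ) :
    IsCoprime (pointIdeal x ^ N) (pointIdeal y ^ N) := by
  apply IsCoprime.pow
  obtain ⟨i, hi⟩ := Function.ne_iff.mp h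
  rw [Ideal.isCoprime_iff_exists]
  refine ⟨C (y i - x i)⁻¹ * (X i - C (x i)), Ideal.mul_mem_left _ _ (X_sub_C_mem_pointIdeal x i),
    -(C (y i - x i)⁻¹ * (X i - C (y i))),
    neg_mem (Ideal.mul_mem_left _ _ (X_sub_C_mem_pointIdeal y i)), ?_⟩
  rw [show C (y i - x i)⁻¹ * (X i - C (x i)) + -(C (y i - x i)⁻¹ * (X i - C (y i))) =
    C (y i - x i)⁻¹ * (C (y i) - C (x i)) by ring, ← C_sub, ← C_mul,
    inv_mul_cancel₀ (sub_ne_zero.mpr hi.symm), C_1]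

theorem taylorCoeff_zero (x : Fin n → ℂ) (f : MvPolynomial (Fin n) ℂ) :
    taylorCoeff x 0 f = eval x f :=
  coeff_zero_translate x f

theorem taylorCoeff_eq_zero_of_mem_pow {x : Fin n → ℂ} {N : ℕ} {f : MvPolynomial (Fin n) ℂ}
    (hf : f ∈ pointIdeal x ^ N) {l : Fin n →₀ ℕ} (hl : l.degree < N) : taylorCoeff x l f = 0 := by
  induction N generalizing f l with
  | zero => exact absurd hl (Nat.not_lt_zero _)
  | succ N ih =>
    rw [pow_succ'] at hf
    induction hf using Submodule.mul_induction_on' with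
    | mem_mul_mem g hg f hf =>
      rw [taylorCoeff_mul]
      refine Finset.sum_eq_zero fun ab hab => ?_
      rw [Finset.HasAntidiagonal.mem_antidiagonal] at hab
      by_cases h0 : ab.1 = 0
      · rw [h0, taylorCoeff_zero, mem_pointIdeal_iff.mp hg, zero_mul]
      · rw [ih hf, mul_zero]
        have h1 : ab.1.degree ≠ 0 := fun h => h0 ((Finsupp.degree_eq_zero_iff _).mp h)
        have h2 : ab.1.degree + ab.2.degree = l.degree := by rw [← hab, map_add]
        omega
    | add f _ g _ hf hg => rw [map_add, hf, hg, add_zero]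

/-- The monomial `(s - x) ^ l`. -/
def shiftedMonomial (x : Fin n → ℂ) (l : Fin n →₀ ℕ) : MvPolynomial (Fin n) ℂ :=
  translate (-x) (monomial l 1)

theorem taylorCoeff_shiftedMonomial (x : Fin n → ℂ) (l k : Fin n →₀ ℕ) :
    taylorCoeff x k (shiftedMonomial x l) = if l = k then 1 else 0 := by
  have := translate_neg_translate (-x) (monomial l (1 : ℂ))
  rw [neg_neg] at this
  rw [taylorCoeff_apply, shiftedMonomial]
  exact (congrArg (coeff k) this).trans (coeff_monomial k l 1)

theorem shiftedMonomial_mem_pow (x : Fin n → ℂ) (l : Fin n →₀ ℕ) :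
    shiftedMonomial x l ∈ pointIdeal x ^ l.degree := by
  rw [shiftedMonomial, monomial_eq, C_1, one_mul, Finsupp.prod_fintype _ _ fun _ => pow_zero _,
    map_prod, Finsupp.degree_eq_sum, ← Finset.prod_pow_eq_pow_sum]
  refine Ideal.prod_mem_prod fun i _ => ?_
  rw [map_pow, translate_X, Pi.neg_apply, C_neg, ← sub_eq_add_neg]
  exact Ideal.pow_mem_pow (X_sub_C_mem_pointIdeal x i) _

theorem eq_sum_shiftedMonomial (x : Fin n → ℂ) (f : MvPolynomial (Fin n) ℂ) :
    f = ∑ l ∈ (translate x f).support, taylorCoeff x l f • shiftedMonomial x l := by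
  conv_lhs => rw [← translate_neg_translate x f, as_sum (translate x f), map_sum]
  refine Finset.sum_congr rfl fun l _ => ?_
  rw [shiftedMonomial, ← map_smul, smul_monomial, smul_eq_mul, mul_one]
  rfl

theorem mem_pow_pointIdeal {x : Fin n → ℂ} {N : ℕ} {f : MvPolynomial (Fin n) ℂ}
    (hf : ∀ l : Fin n →₀ ℕ, l.degree < N → taylorCoeff x l f = 0) : f ∈ pointIdeal x ^ N := by
  rw [eq_sum_shiftedMonomial x f]
  refine Ideal.sum_mem _ fun l _ => ?_
  by_cases hl : l.degree < N
  · rw [hf l hl, zero_smul]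
    exact zero_mem _
  · rw [smul_eq_C_mul]
    exact Ideal.mul_mem_left _ _
      (Ideal.pow_le_pow_right (not_lt.mp hl) (shiftedMonomial_mem_pow x l))

/-- A finite set of multi-exponents that contains those of degree less than `N`. -/
def exponentBox (n N : ℕ) : Finset (Fin n →₀ ℕ) :=
  Finset.Iic (Finsupp.equivFunOnFinite.symm fun _ => N)

theorem mem_exponentBox {N : ℕ} {l : Fin n →₀ ℕ} (hl : l.degree < N) : l ∈ exponentBox n N := by
  rw [exponentBox, Finset.mem_Iic]
  intro i
  exact (Finsupp.le_degree i l).trans hl.le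

theorem sub_taylor_mem_pow (x : Fin n → ℂ) (N : ℕ) (f : MvPolynomial (Fin n) ℂ) :
    f - ∑ l ∈ exponentBox n N, taylorCoeff x l f • shiftedMonomial x l ∈ pointIdeal x ^ N := by
  refine mem_pow_pointIdeal fun l hl => ?_
  simp only [map_sub, map_sum, map_smul, taylorCoeff_shiftedMonomial]
  simp [mem_exponentBox hl]

theorem applyPoly_congr {Q : MvPolynomial (Fin n) ℂ} {x : Fin n → ℂ} {N : ℕ}
    (hN : Q.totalDegree < N) {f g : MvPolynomial (Fin n) ℂ} (h : f - g ∈ pointIdeal x ^ N) :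
    applyPoly Q x f = applyPoly Q x g := by
  rw [applyPoly_eq_sum _ _ _ subset_rfl, applyPoly_eq_sum _ _ _ subset_rfl]
  refine Finset.sum_congr rfl fun l hl => ?_
  have := taylorCoeff_eq_zero_of_mem_pow h ((le_totalDegree hl).trans_lt hN)
  rw [map_sub, sub_eq_zero] at this
  rw [this]

end Points

/-! ### The local structure of `ℂ[s] / (p)` -/

section Local

variable {n m : ℕ} {p : Fin n → MvPolynomial (Fin n) ℂ} {w : Fin m → Fin n → ℂ}

theorem exists_sub_mem_pow_pointIdeal (hw : Function.Injective w) (N : ℕ)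
    (T : Fin m → MvPolynomial (Fin n) ℂ) : ∃ f, ∀ j, f - T j ∈ pointIdeal (w j) ^ N :=
  Ideal.exists_forall_sub_mem_ideal (I := fun j => pointIdeal (w j) ^ N)
    (fun _ _ h => isCoprime_pointIdeal_pow (hw.ne h) N) T

/-- By the Nullstellensatz the intersection of the maximal ideals of the wⱼ lies in the radical of
(p), a power of which lies in (p). Comaximality turns the intersection of the M-th powers into the
M-th power of a product. -/
theorem exists_mem_polyIdeal_of_mem_pow (hw : Function.Injective w)
    (hzero : Set.range w = zeroSet p) :
    ∃ M, ∀ f, (∀ j, f ∈ pointIdeal (w j) ^ M) → f ∈ polyIdeal p := by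
  obtain ⟨M, hM⟩ := Ideal.exists_radical_pow_le_of_fg (polyIdeal p)
    (IsNoetherian.noetherian (polyIdeal p).radical)
  refine ⟨M, fun f hf => hM ?_⟩
  have hrad : ⨅ j, pointIdeal (w j) ≤ (polyIdeal p).radical := by
    rw [← vanishingIdeal_zeroLocus_eq_radical (K := ℂ)]
    intro g hg x hx
    rw [polyIdeal, zeroLocus_span] at hx
    have hx' : x ∈ zeroSet p := fun j => by
      have := hx (p j) ⟨j, rfl⟩
      simpa [aeval_eq_eval] using this
    rw [← hzero] at hx'
    obtain ⟨j, rfl⟩ := hx'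
    rw [aeval_eq_eval]
    exact mem_pointIdeal_iff.mp ((Ideal.mem_iInf.mp hg) j)
  have h1 : f ∈ ⨅ j ∈ Finset.univ, pointIdeal (w j) ^ M := by
    simpa [Submodule.mem_iInf] using hf
  rw [← Ideal.prod_eq_iInf_of_pairwise_isCoprime
    (fun _ _ _ _ h => isCoprime_pointIdeal_pow (hw.ne h) M), Finset.prod_pow] at h1
  refine Ideal.pow_right_mono (le_trans ?_ hrad) M h1
  exact Ideal.prod_le_inf.trans (by simp [Finset.inf_eq_iInf])

theorem exists_mem_polyIdeal_of_mem_sup (hw : Function.Injective w)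
    (hzero : Set.range w = zeroSet p) :
    ∃ M, ∀ f, (∀ j, f ∈ polyIdeal p ⊔ pointIdeal (w j) ^ M) → f ∈ polyIdeal p := by
  obtain ⟨M, hM⟩ := exists_mem_polyIdeal_of_mem_pow hw hzero
  refine ⟨M, fun f hf => ?_⟩
  choose a ha b hb hab using fun j => Submodule.mem_sup.mp (hf j)
  -- The `e j` form a partition of unity modulo (p): `e j` is 1 to order M at `w j` and 0 to order M
  -- at the other zeros.
  choose e he using fun j => exists_sub_mem_pow_pointIdeal hw M
    (fun k => if k = j then (1 : MvPolynomial (Fin n) ℂ) else 0)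
  have h1 : 1 - ∑ j, e j ∈ polyIdeal p := by
    refine hM _ fun k => ?_
    have := Ideal.sum_mem (pointIdeal (w k) ^ M) fun j (_ : j ∈ Finset.univ) => he j k
    rw [Finset.sum_sub_distrib, Finset.sum_ite_eq Finset.univ k, if_pos (Finset.mem_univ k)] at this
    rw [← neg_sub]
    exact neg_mem this
  have h2 : ∀ j, e j * f ∈ polyIdeal p := by
    intro j
    rw [← hab j, mul_add]
    refine add_mem (Ideal.mul_mem_left _ _ (ha j)) (hM _ fun k => ?_)
    by_cases h : k = j
    · subst h; exact Ideal.mul_mem_left _ _ (hb k)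
    · have := he j k
      rw [if_neg h, sub_zero] at this
      exact Ideal.mul_mem_right _ _ this
  have h3 := add_mem (Ideal.mul_mem_right f _ h1)
    (Ideal.sum_mem _ fun j (_ : j ∈ Finset.univ) => h2 j)
  rwa [← Finset.sum_mul, ← add_mul, sub_add_cancel, one_mul] at h3

theorem polyIdeal_ne_top (hm : 0 < m) (hzero : Set.range w = zeroSet p) : polyIdeal p ≠ ⊤ := by
  intro h
  have hz : w ⟨0, hm⟩ ∈ zeroSet p := hzero ▸ Set.mem_range_self _
  have hle : polyIdeal p ≤ RingHom.ker (eval (w ⟨0, hm⟩)) := by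
    rw [polyIdeal, Ideal.span_le]
    rintro _ ⟨j, rfl⟩
    exact hz j
  have : (1 : MvPolynomial (Fin n) ℂ) ∈ RingHom.ker (eval (w ⟨0, hm⟩)) := hle (h ▸ trivial)
  simp [RingHom.mem_ker] at this

theorem exists_isUnivariateReduction (hw : Function.Injective w)
    (hzero : Set.range w = zeroSet p) : ∃ q A, IsUnivariateReduction p q A := by
  obtain ⟨M, hM⟩ := exists_mem_polyIdeal_of_mem_pow hw hzero
  -- qᵢ(sᵢ) vanishes to order M at every zero, hence lies in (p).
  let q : Fin n → Polynomial ℂ := fun i => ∏ j, (Polynomial.X - Polynomial.C (w j i)) ^ M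
  have hq : ∀ i, Polynomial.aeval (X i : MvPolynomial (Fin n) ℂ) (q i) ∈ polyIdeal p := by
    refine fun i => hM _ fun j => ?_
    simp only [q, map_prod, map_pow, map_sub, Polynomial.aeval_X, Polynomial.aeval_C]
    exact Ideal.mem_of_dvd _ (Finset.dvd_prod_of_mem _ (Finset.mem_univ j))
      (Ideal.pow_mem_pow (X_sub_C_mem_pointIdeal (w j) i) M)
  simp only [polyIdeal, Ideal.mem_span_range_iff_exists_fun] at hq
  choose A hA using hq
  exact ⟨q, Matrix.of A, fun i => Polynomial.monic_prod_of_monic _ _ fun j _ =>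
    (Polynomial.monic_X_sub_C _).pow M, fun i => (hA i).symm⟩

/-- Modulo (p), g is ∑ⱼ eⱼ Tⱼ with eⱼ a partition of unity and Tⱼ a Taylor polynomial of g at wⱼ; so
lam g is linear in finitely many Taylor coefficients. Division by l! converts these into
derivatives. -/
theorem exists_operators (hw : Function.Injective w) (hzero : Set.range w = zeroSet p)
    (lam : MvPolynomial (Fin n) ℂ →ₗ[ℂ] ℂ) (hlam : ∀ f ∈ polyIdeal p, lam f = 0) :
    ∃ Q : Fin m → MvPolynomial (Fin n) ℂ, ∀ g, lam g = ∑ j, applyPoly (Q j) (w j) g := by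
  obtain ⟨M, hM⟩ := exists_mem_polyIdeal_of_mem_pow hw hzero
  choose e he using fun j => exists_sub_mem_pow_pointIdeal hw M
    (fun k => if k = j then (1 : MvPolynomial (Fin n) ℂ) else 0)
  refine ⟨fun j => ∑ l ∈ exponentBox n M,
    monomial l (lam (e j * shiftedMonomial (w j) l) * (multiFactorial l : ℂ)⁻¹), fun g => ?_⟩
  let T : Fin m → MvPolynomial (Fin n) ℂ := fun j =>
    ∑ l ∈ exponentBox n M, taylorCoeff (w j) l g • shiftedMonomial (w j) l
  have h1 : g - ∑ j, e j * T j ∈ polyIdeal p := by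
    refine hM _ fun k => ?_
    have h := Ideal.sum_mem (pointIdeal (w k) ^ M) fun j (_ : j ∈ Finset.univ) =>
      Ideal.mul_mem_right (T j) _ (he j k)
    simp only [sub_mul, ite_mul, one_mul, zero_mul] at h
    rw [Finset.sum_sub_distrib, Finset.sum_ite_eq Finset.univ k, if_pos (Finset.mem_univ k)] at h
    have := sub_mem (sub_taylor_mem_pow (w k) M g) h
    rwa [show g - (∑ l ∈ exponentBox n M, taylorCoeff (w k) l g • shiftedMonomial (w k) l) -
      (∑ j, e j * T j - T k) = g - ∑ j, e j * T j by simp only [T]; ring] at this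
  have h2 := hlam _ h1
  rw [map_sub, sub_eq_zero, map_sum] at h2
  rw [h2]
  refine Finset.sum_congr rfl fun j _ => ?_
  have hs : (∑ l ∈ exponentBox n M, monomial l
      (lam (e j * shiftedMonomial (w j) l) * (multiFactorial l : ℂ)⁻¹)).support ⊆
      exponentBox n M := by
    refine support_sum.trans (Finset.biUnion_subset.mpr fun l hl => ?_)
    exact support_monomial_subset.trans (Finset.singleton_subset_iff.mpr hl)
  rw [applyPoly_eq_sum _ _ _ hs, Finset.mul_sum, map_sum]
  refine Finset.sum_congr rfl fun l hl => ?_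
  rw [coeff_sum]
  simp only [coeff_monomial]
  rw [Finset.sum_ite_eq' _ l, if_pos hl, mul_assoc, inv_mul_cancel₀ (multiFactorial_ne_zero l),
    mul_one, mul_smul_comm, map_smul, smul_eq_mul, smul_eq_mul, mul_comm]

theorem operators_unique (hw : Function.Injective w) {Q Q' : Fin m → MvPolynomial (Fin n) ℂ}
    (h : ∀ g : MvPolynomial (Fin n) ℂ,
      ∑ j, applyPoly (Q j) (w j) g = ∑ j, applyPoly (Q' j) (w j) g) : Q = Q' := by
  funext j
  ext l
  -- The test polynomial g agrees with (s - wⱼ)^l at wⱼ and with 0 at the other zeros, to an order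
  -- above all degrees involved; it isolates the coefficient of exponent l in the j-th symbol.
  obtain ⟨g, hg⟩ := exists_sub_mem_pow_pointIdeal hw
    (∑ k, ((Q k).totalDegree + (Q' k).totalDegree) + 1)
    (fun k => if k = j then shiftedMonomial (w j) l else 0)
  have hle : ∀ k, (Q k).totalDegree + (Q' k).totalDegree ≤
      ∑ k, ((Q k).totalDegree + (Q' k).totalDegree) := fun k =>
    Finset.single_le_sum (f := fun k => (Q k).totalDegree + (Q' k).totalDegree)
      (fun _ _ => Nat.zero_le _) (Finset.mem_univ k)
  have key : ∀ P : Fin m → MvPolynomial (Fin n) ℂ, (∀ k, (P k).totalDegree <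
      ∑ k, ((Q k).totalDegree + (Q' k).totalDegree) + 1) →
      ∑ k, applyPoly (P k) (w k) g = coeff l (P j) * multiFactorial l := by
    intro P hP
    rw [Finset.sum_congr rfl fun k _ => applyPoly_congr (hP k) (hg k),
      Finset.sum_eq_single j, if_pos rfl, applyPoly_eq_sum _ _ _ subset_rfl]
    · simp only [taylorCoeff_shiftedMonomial, smul_eq_mul, mul_ite, mul_one, mul_zero]
      rw [Finset.sum_ite_eq]
      by_cases hl : l ∈ (P j).support
      · rw [if_pos hl]
      · rw [if_neg hl, notMem_support_iff.mp hl, zero_mul]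
    · intro k _ hk
      rw [if_neg hk, applyPoly_eq_sum _ _ _ subset_rfl]
      simp
    · exact fun h => absurd (Finset.mem_univ j) h
  have := h g
  rw [key Q fun k => by have := hle k; omega, key Q' fun k => by have := hle k; omega] at this
  exact mul_right_cancel₀ (multiFactorial_ne_zero l) this

/-- The operators that represent the residue exist and are unique. -/
theorem existsUnique_representsResidue (hm : 0 < m) (hw : Function.Injective w)
    (hzero : Set.range w = zeroSet p) :
    ∃! Q : Fin m → MvPolynomial (Fin n) ℂ, RepresentsResidue p w Q := by
  obtain ⟨q, A, hA⟩ := exists_isUnivariateReduction hw hzero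
  obtain ⟨B, hB⟩ := exists_isBezoutian p
  obtain ⟨Q, hQ⟩ := exists_operators hw hzero (residueForm q A) fun f => residueForm_eq_zero hA
  refine ⟨Q, fun q' A' hA' g => ?_, fun Q' hQ' => operators_unique hw fun g => ?_⟩
  · rw [residueVia_eq, residueForm_unique (polyIdeal_ne_top hm hzero) hB hA' hA, hQ]
  · rw [← hQ' q A hA g, residueVia_eq, hQ]

end Local

/-! ### The local ring of germs -/

section Germs

variable {n : ℕ}

/-- Hadamard's lemma: an analytic function is its value plus a linear form with analytic
coefficients. -/
theorem exists_analyticAt_hadamard {E F : Type*} [NormedAddCommGroup E] [NormedSpace ℂ E]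
    [NormedAddCommGroup F] [NormedSpace ℂ F] [CompleteSpace F] {f : E → F} {x : E}
    (hf : AnalyticAt ℂ f x) :
    ∃ g : E → E →L[ℂ] F, AnalyticAt ℂ g x ∧ ∀ᶠ y in 𝓝 x, f y = f x + g y (y - x) := by
  obtain ⟨P, r, hP⟩ := hf
  have hrad : 0 < P.shift.radius := by
    rw [P.radius_shift]
    exact hP.r_pos.trans_le hP.r_le
  have h1 := (P.shift.hasFPowerSeriesOnBall hrad).comp_sub x
  rw [zero_add] at h1
  refine ⟨_, h1.analyticAt, ?_⟩
  have h2 := (h1.unshift (z := f x)).mono (lt_min h1.r_pos hP.r_pos) (min_le_left _ r)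
  have h3 := hP.mono (lt_min h1.r_pos hP.r_pos) (min_le_right P.shift.radius r)
  -- The series of y ↦ f x + g y (y - x) is thus that of f, and the two functions agree on a common
  -- ball.
  have hP0 : P.shift.unshift (f x) = P := by
    funext k
    cases k with
    | zero =>
      ext v
      exact (hP.coeff_zero v).symm
    | succ k => exact (continuousMultilinearCurryRightEquiv' ℂ k E F).symm_apply_apply (P (k + 1))
  rw [hP0] at h2
  filter_upwards [Metric.eball_mem_nhds x (lt_min h1.r_pos hP.r_pos)] with y hy
  exact h3.unique h2 hy

theorem analyticAt_clm_apply {x : Fin n → ℂ} {g : (Fin n → ℂ) → (Fin n → ℂ) →L[ℂ] ℂ}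
    (hg : AnalyticAt ℂ g x) (v : Fin n → ℂ) : AnalyticAt ℂ (fun s => g s v) x :=
  ((ContinuousLinearMap.apply ℂ ℂ v).analyticAt (g x)).comp hg

/-- The ring homomorphism that sends a polynomial to its germ at `x`. -/
def polyGermHom (x : Fin n → ℂ) : MvPolynomial (Fin n) ℂ →+* HolGerm x where
  toFun := polyGerm x
  map_one' := Subtype.ext (congrArg (fun f : (Fin n → ℂ) → ℂ => (f : Germ (𝓝 x) ℂ))
    (funext fun s => map_one (eval s)))
  map_mul' P Q := Subtype.ext (congrArg (fun f : (Fin n → ℂ) → ℂ => (f : Germ (𝓝 x) ℂ))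
    (funext fun s => map_mul (eval s) P Q))
  map_zero' := Subtype.ext (congrArg (fun f : (Fin n → ℂ) → ℂ => (f : Germ (𝓝 x) ℂ))
    (funext fun s => map_zero (eval s)))
  map_add' P Q := Subtype.ext (congrArg (fun f : (Fin n → ℂ) → ℂ => (f : Germ (𝓝 x) ℂ))
    (funext fun s => map_add (eval s) P Q))

theorem polyGermHom_apply (x : Fin n → ℂ) (P : MvPolynomial (Fin n) ℂ) :
    polyGermHom x P = polyGerm x P := rfl

theorem localIdeal_eq_map (p : Fin n → MvPolynomial (Fin n) ℂ) (x : Fin n → ℂ) :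
    localIdeal p x = (polyIdeal p).map (polyGermHom x) := by
  rw [localIdeal, polyIdeal, Ideal.map_span, ← Set.range_comp]
  rfl

/-- The maximal ideal of the local ring of germs at `x`. -/
def germIdeal (x : Fin n → ℂ) : Ideal (HolGerm x) := (pointIdeal x).map (polyGermHom x)

theorem polyGermHom_mem_pow {x : Fin n → ℂ} {N : ℕ} {f : MvPolynomial (Fin n) ℂ}
    (hf : f ∈ pointIdeal x ^ N) : polyGermHom x f ∈ germIdeal x ^ N := by
  rw [germIdeal, ← Ideal.map_pow]
  exact Ideal.mem_map_of_mem _ hf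

theorem exists_hadamard {x : Fin n → ℂ} (h : HolGerm x) :
    ∃ (c : ℂ) (g : Fin n → HolGerm x),
      h = polyGermHom x (C c) + ∑ i, polyGermHom x (X i - C (x i)) * g i := by
  obtain ⟨h, f, hf, rfl⟩ := h
  obtain ⟨g, hg, hfg⟩ := exists_analyticAt_hadamard hf
  refine ⟨f x, fun i => ⟨((fun s => g s (Pi.single i 1) : (Fin n → ℂ) → ℂ) : Germ (𝓝 x) ℂ),
    fun s => g s (Pi.single i 1),
    analyticAt_clm_apply hg _, rfl⟩, ?_⟩
  apply Subtype.ext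
  have hsum : ((∑ i, polyGermHom x (X i - C (x i)) *
      (⟨((fun s => g s (Pi.single i 1) : (Fin n → ℂ) → ℂ) : Germ (𝓝 x) ℂ),
        fun s => g s (Pi.single i 1), analyticAt_clm_apply hg _, rfl⟩ : HolGerm x) : HolGerm x) :
      Germ (𝓝 x) ℂ) = ((∑ i, fun s => eval s (X i - C (x i)) * g s (Pi.single i 1) :
        (Fin n → ℂ) → ℂ) : Germ (𝓝 x) ℂ) := by
    rw [AddSubmonoidClass.coe_finsetSum]
    exact (map_sum (Germ.coeAddHom (𝓝 x)) (fun (i : Fin n) (s : Fin n → ℂ) =>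
      eval s (X i - C (x i)) * g s (Pi.single i 1)) Finset.univ).symm
  rw [Subring.coe_add, hsum]
  refine Germ.coe_eq.mpr ?_
  filter_upwards [hfg] with s hs
  have hlin : g s (s - x) = ∑ i, eval s (X i - C (x i)) * g s (Pi.single i 1) := by
    conv_lhs => rw [← Finset.univ_sum_single (s - x), map_sum]
    refine Finset.sum_congr rfl fun i _ => ?_
    rw [← smul_eq_mul, ← map_smul, ← Pi.single_smul, smul_eq_mul, mul_one, map_sub, eval_X, eval_C]
    rfl
  rw [hs, hlin]
  simp only [Finset.sum_apply, eval_C]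

theorem exists_sub_polyGermHom_mem_pow {x : Fin n → ℂ} (N : ℕ) (h : HolGerm x) :
    ∃ T, h - polyGermHom x T ∈ germIdeal x ^ N := by
  induction N generalizing h with
  | zero => exact ⟨0, by simp⟩
  | succ N ih =>
    obtain ⟨c, g, hg⟩ := exists_hadamard h
    choose T hT using fun i => ih (g i)
    refine ⟨C c + ∑ i, (X i - C (x i)) * T i, ?_⟩
    rw [hg, map_add, add_sub_add_left_eq_sub, map_sum, ← Finset.sum_sub_distrib]
    refine Ideal.sum_mem _ fun i _ => ?_
    rw [map_mul, ← mul_sub, pow_succ']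
    exact Ideal.mul_mem_mul (Ideal.mem_map_of_mem _ (X_sub_C_mem_pointIdeal x i)) (hT i)

/-- The partial derivative of a germ of holomorphic function. -/
def holPartial {x : Fin n → ℂ} (i : Fin n) (h : HolGerm x) : HolGerm x :=
  ⟨Quotient.liftOn' (h : Germ (𝓝 x) ℂ) (fun f => (partialDeriv i f : Germ (𝓝 x) ℂ))
    fun f g hfg => Germ.coe_eq.mpr (by
      filter_upwards [EventuallyEq.fderiv (𝕜 := ℂ) hfg] with s hs
      simp only [partialDeriv, hs]), by
    obtain ⟨h, f, hf, rfl⟩ := h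
    exact ⟨partialDeriv i f, analyticAt_clm_apply hf.fderiv _, rfl⟩⟩

theorem coe_holPartial {x : Fin n → ℂ} (i : Fin n) {h : HolGerm x} {f : (Fin n → ℂ) → ℂ}
    (hf : (h : Germ (𝓝 x) ℂ) = f) :
    (holPartial i h : Germ (𝓝 x) ℂ) = (partialDeriv i f : (Fin n → ℂ) → ℂ) := by
  obtain ⟨h, hh⟩ := h
  obtain rfl : h = f := hf
  rfl

theorem holPartial_add {x : Fin n → ℂ} (i : Fin n) (g h : HolGerm x) :
    holPartial i (g + h) = holPartial i g + holPartial i h := by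
  obtain ⟨g, f, hf, rfl⟩ := g
  obtain ⟨h, k, hk, rfl⟩ := h
  apply Subtype.ext
  refine Germ.coe_eq.mpr ?_
  filter_upwards [hf.eventually_analyticAt, hk.eventually_analyticAt] with s hfs hks
  rw [partialDeriv, fderiv_fun_add hfs.differentiableAt hks.differentiableAt]
  rfl

theorem holPartial_mul {x : Fin n → ℂ} (i : Fin n) (g h : HolGerm x) :
    holPartial i (g * h) = g * holPartial i h + h * holPartial i g := by
  obtain ⟨g, f, hf, rfl⟩ := g
  obtain ⟨h, k, hk, rfl⟩ := h
  apply Subtype.ext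
  refine Germ.coe_eq.mpr ?_
  filter_upwards [hf.eventually_analyticAt, hk.eventually_analyticAt] with s hfs hks
  rw [partialDeriv, fderiv_fun_mul hfs.differentiableAt hks.differentiableAt]
  rfl

/-- The value of a germ of holomorphic function. -/
def holValue {x : Fin n → ℂ} : HolGerm x →+* ℂ :=
  (Germ.valueRingHom : Germ (𝓝 x) ℂ →+* ℂ).comp (HolGerm x).subtype

theorem partialDeriv_eval (i : Fin n) (P : MvPolynomial (Fin n) ℂ) :
    partialDeriv i (fun s => eval s P) = fun s => eval s (pderiv i P) := by
  have hd : ∀ (P : MvPolynomial (Fin n) ℂ) s, DifferentiableAt ℂ (fun s => eval s P) s :=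
    fun P s => (AnalyticOnNhd.eval_mvPolynomial P s trivial).differentiableAt
  funext s
  unfold partialDeriv
  induction P using MvPolynomial.induction_on with
  | C c => simp
  | add P Q hP hQ =>
    simp only [map_add]
    rw [fderiv_fun_add (hd P s) (hd Q s), add_apply, hP, hQ]
  | mul_X P j hP =>
    simp only [map_mul]
    rw [fderiv_fun_mul (hd P s) (hd (X j) s), add_apply,
      smul_apply, smul_apply, hP]
    have hX : fderiv ℂ (fun s : Fin n → ℂ => eval s (X j)) s = ContinuousLinearMap.proj j := by
      simp only [eval_X]
      exact (ContinuousLinearMap.proj (R := ℂ) (φ := fun _ : Fin n => ℂ) j).fderiv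
    rw [hX, Derivation.leibniz, pderiv_X, map_add]
    simp only [smul_eq_mul, map_mul, eval_X, ContinuousLinearMap.proj_apply]
    congr 2
    by_cases h : j = i
    · subst h; simp
    · simp [h]

theorem holPartial_polyGermHom (x : Fin n → ℂ) (i : Fin n) (P : MvPolynomial (Fin n) ℂ) :
    holPartial i (polyGermHom x P) = polyGermHom x (pderiv i P) :=
  Subtype.ext (congrArg (fun f : (Fin n → ℂ) → ℂ => (f : Germ (𝓝 x) ℂ)) (partialDeriv_eval i P))

/-- The iterated partial derivatives of a germ of holomorphic function. -/
def holIterPartial {x : Fin n → ℂ} (l : Fin n →₀ ℕ) (h : HolGerm x) : HolGerm x :=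
  (List.finRange n).foldr (fun i g => (holPartial i)^[l i] g) h

theorem germDeriv_eq_holValue {x : Fin n → ℂ} (l : Fin n →₀ ℕ) (h : HolGerm x) :
    germDeriv l (h : Germ (𝓝 x) ℂ) = holValue (holIterPartial l h) := by
  obtain ⟨h, f, hf, rfl⟩ := h
  have key : ∀ t : List (Fin n), ((t.foldr (fun i g => (holPartial i)^[l i] g)
      (⟨(f : Germ (𝓝 x) ℂ), f, hf, rfl⟩ : HolGerm x) : HolGerm x) : Germ (𝓝 x) ℂ) =
        ((t.foldr (fun i g => (partialDeriv i)^[l i] g) f : (Fin n → ℂ) → ℂ) : Germ (𝓝 x) ℂ) := by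
    intro t
    induction t with
    | nil => rfl
    | cons i t ih =>
      simp only [List.foldr_cons]
      induction l i with
      | zero => exact ih
      | succ k ihk =>
        rw [Function.iterate_succ_apply', Function.iterate_succ_apply']
        exact coe_holPartial i ihk
  have h := congrArg Germ.value (key (List.finRange n))
  exact h.symm

theorem holIterPartial_add {x : Fin n → ℂ} (l : Fin n →₀ ℕ) (g h : HolGerm x) :
    holIterPartial l (g + h) = holIterPartial l g + holIterPartial l h := by
  unfold holIterPartial
  induction List.finRange n with
  | nil => rfl
  | cons i t ih =>
    simp only [List.foldr_cons, ih]
    induction l i with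
    | zero => rfl
    | succ k ihk => simp only [Function.iterate_succ_apply', ihk, holPartial_add]

theorem holIterPartial_polyGermHom (x : Fin n → ℂ) (l : Fin n →₀ ℕ)
    (P : MvPolynomial (Fin n) ℂ) :
    holIterPartial l (polyGermHom x P) = polyGermHom x (polyIterPartial l P) := by
  unfold holIterPartial polyIterPartial
  induction List.finRange n with
  | nil => rfl
  | cons i t ih =>
    simp only [List.foldr_cons, ih]
    induction l i with
    | zero => rfl
    | succ k ihk => simp only [Function.iterate_succ_apply', ihk, holPartial_polyGermHom]

theorem holPartial_mem_pow {x : Fin n → ℂ} (i : Fin n) {N : ℕ} {h : HolGerm x}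
    (hh : h ∈ germIdeal x ^ (N + 1)) : holPartial i h ∈ germIdeal x ^ N := by
  induction N generalizing h with
  | zero => simp
  | succ N ih =>
    rw [pow_succ'] at hh
    induction hh using Submodule.mul_induction_on' with
    | mem_mul_mem g hg f hf =>
      rw [holPartial_mul]
      refine add_mem ?_ (Ideal.mul_mem_right _ _ hf)
      rw [pow_succ']
      exact Ideal.mul_mem_mul hg (ih hf)
    | add f _ g _ hf hg =>
      rw [holPartial_add]
      exact add_mem hf hg

theorem holIterPartial_mem {x : Fin n → ℂ} {l : Fin n →₀ ℕ} {N : ℕ} (hl : l.degree < N)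
    {h : HolGerm x} (hh : h ∈ germIdeal x ^ N) : holIterPartial l h ∈ germIdeal x := by
  have h1 : ∀ i k N (g : HolGerm x), g ∈ germIdeal x ^ (N + k) →
      (holPartial i)^[k] g ∈ germIdeal x ^ N := by
    intro i k
    induction k with
    | zero => exact fun N g hg => hg
    | succ k ih =>
      intro N g hg
      rw [Function.iterate_succ_apply']
      exact holPartial_mem_pow i (ih (N + 1) g (by rwa [add_assoc, add_comm 1 k]))
  have h2 : ∀ (t : List (Fin n)) N, h ∈ germIdeal x ^ (N + (t.map l).sum) →
      t.foldr (fun i g => (holPartial i)^[l i] g) h ∈ germIdeal x ^ N := by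
    intro t
    induction t with
    | nil => exact fun N hg => hg
    | cons i t ih =>
      intro N hg
      rw [List.map_cons, List.sum_cons, ← add_assoc] at hg
      exact h1 i (l i) N _ (ih (N + l i) hg)
  have h3 := h2 (List.finRange n) 1 (Ideal.pow_le_pow_right (by
    rw [← Fin.sum_univ_def, ← Finsupp.degree_eq_sum]; omega) hh)
  rwa [pow_one] at h3

theorem holValue_polyGermHom (x : Fin n → ℂ) (P : MvPolynomial (Fin n) ℂ) :
    holValue (polyGermHom x P) = eval x P := rfl

theorem holValue_eq_zero {x : Fin n → ℂ} {h : HolGerm x} (hh : h ∈ germIdeal x) :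
    holValue h = 0 := by
  have hle : germIdeal x ≤ RingHom.ker holValue := by
    rw [germIdeal, Ideal.map_le_iff_le_comap]
    intro f hf
    exact mem_pointIdeal_iff.mp hf
  exact hle hh

/-- Each partial derivative lowers the order of vanishing by at most one, so fewer than N of them do
not see an error in the N-th power. -/
theorem germDeriv_eq_evalAt {x : Fin n → ℂ} {h : HolGerm x} {T : MvPolynomial (Fin n) ℂ} {N : ℕ}
    (hT : h - polyGermHom x T ∈ germIdeal x ^ N) {l : Fin n →₀ ℕ} (hl : l.degree < N) :
    germDeriv l (h : Germ (𝓝 x) ℂ) = evalAt x (polyIterPartial l T) := by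
  rw [germDeriv_eq_holValue, ← sub_add_cancel h (polyGermHom x T), holIterPartial_add, map_add,
    holValue_eq_zero (holIterPartial_mem hl hT), zero_add, holIterPartial_polyGermHom,
    holValue_polyGermHom]
  rfl

theorem mem_pow_of_polyGermHom_mem_pow {x : Fin n → ℂ} {N : ℕ} {f : MvPolynomial (Fin n) ℂ}
    (hf : polyGermHom x f ∈ germIdeal x ^ N) : f ∈ pointIdeal x ^ N := by
  refine mem_pow_pointIdeal fun l hl => ?_
  -- Both 0 and f approximate the germ of f to order N, so their derivatives of order below N agree
  -- at x.
  have h1 := germDeriv_eq_evalAt (x := x) (h := polyGermHom x f) (T := 0) (by simpa using hf) hl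
  have h2 := germDeriv_eq_evalAt (x := x) (h := polyGermHom x f) (T := f) (N := N) (by simp) hl
  rw [h1, evalAt_polyIterPartial, evalAt_polyIterPartial, map_zero, smul_zero, eq_comm,
    smul_eq_mul] at h2
  exact (mul_eq_zero.mp h2).resolve_left (multiFactorial_ne_zero l)

/-- Truncating the analytic coefficients of the pₖ to polynomials costs only an error of order N. -/
theorem mem_sup_of_polyGermHom_mem {p : Fin n → MvPolynomial (Fin n) ℂ} {x : Fin n → ℂ}
    {f : MvPolynomial (Fin n) ℂ} (hf : polyGermHom x f ∈ localIdeal p x) (N : ℕ) :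
    f ∈ polyIdeal p ⊔ pointIdeal x ^ N := by
  rw [localIdeal, Ideal.mem_span_range_iff_exists_fun] at hf
  obtain ⟨c, hc⟩ := hf
  choose G hG using fun k => exists_sub_polyGermHom_mem_pow N (c k)
  have h1 : f - ∑ k, G k * p k ∈ pointIdeal x ^ N := by
    apply mem_pow_of_polyGermHom_mem_pow
    rw [map_sub, ← hc, map_sum, ← Finset.sum_sub_distrib]
    refine Ideal.sum_mem _ fun k _ => ?_
    rw [map_mul, polyGermHom_apply x (p k), ← sub_mul]
    exact Ideal.mul_mem_right _ _ (hG k)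
  have h2 : ∑ k, G k * p k ∈ polyIdeal p :=
    Ideal.sum_mem _ fun k _ => Ideal.mul_mem_left _ _ (mem_polyIdeal p k)
  exact Submodule.mem_sup.mpr ⟨_, h2, _, h1, by ring⟩

theorem isUnit_polyGermHom {x : Fin n → ℂ} {e : MvPolynomial (Fin n) ℂ} (he : eval x e ≠ 0) :
    IsUnit (polyGermHom x e) := by
  have ha : AnalyticAt ℂ (fun s => eval s e) x := AnalyticOnNhd.eval_mvPolynomial e x trivial
  refine IsUnit.of_mul_eq_one ⟨((fun s => (eval s e)⁻¹ : (Fin n → ℂ) → ℂ) : Germ (𝓝 x) ℂ),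
    fun s => (eval s e)⁻¹, ha.fun_inv he, rfl⟩ (Subtype.ext (Germ.coe_eq.mpr ?_))
  filter_upwards [ha.continuousAt.eventually_ne he] with s hs
  exact mul_inv_cancel₀ hs

end Germs

/-! ### Interpolation -/

section Interpolation

variable {n m : ℕ} {p : Fin n → MvPolynomial (Fin n) ℂ} {w : Fin m → Fin n → ℂ}

/-- If g vanishes to order M at wⱼ and e is 1 near wⱼ but 0 at the other zeros to high order, then e
g ∈ (p), and e is a unit in the local ring at wⱼ. -/
theorem exists_germIdeal_pow_le_localIdeal (hw : Function.Injective w)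
    (hzero : Set.range w = zeroSet p) :
    ∃ M, ∀ j, germIdeal (w j) ^ M ≤ localIdeal p (w j) := by
  obtain ⟨M, hM⟩ := exists_mem_polyIdeal_of_mem_pow hw hzero
  refine ⟨M, fun j => ?_⟩
  rw [germIdeal, ← Ideal.map_pow, Ideal.map_le_iff_le_comap]
  intro g hg
  -- The exponent M + 1 is positive, which ensures e(wⱼ) = 1 even if M = 0.
  obtain ⟨e, he⟩ := exists_sub_mem_pow_pointIdeal hw (M + 1)
    (fun k => if k = j then (1 : MvPolynomial (Fin n) ℂ) else 0)
  have he1 : eval (w j) e ≠ 0 := by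
    have := he j
    rw [if_pos rfl] at this
    have := mem_pointIdeal_iff.mp (Ideal.pow_le_self (Nat.succ_ne_zero M) this)
    rw [map_sub, map_one, sub_eq_zero] at this
    rw [this]
    exact one_ne_zero
  have heg : e * g ∈ polyIdeal p := by
    refine hM _ fun k => ?_
    by_cases h : k = j
    · subst h; exact Ideal.mul_mem_left _ _ hg
    · have := he k
      rw [if_neg h, sub_zero] at this
      exact Ideal.mul_mem_right _ _ (Ideal.pow_le_pow_right (Nat.le_succ M) this)
  have h1 := Ideal.mem_map_of_mem (polyGermHom (w j)) heg
  rw [← localIdeal_eq_map, map_mul] at h1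
  exact (Ideal.unit_mul_mem_iff_mem _ (isUnit_polyGermHom he1)).mp h1

theorem exists_sub_polyGermHom_mem_pow_forall (hw : Function.Injective w) (N : ℕ)
    (h : ∀ j, HolGerm (w j)) :
    ∃ T, ∀ j, h j - polyGermHom (w j) T ∈ germIdeal (w j) ^ N := by
  choose T hT using fun j => exists_sub_polyGermHom_mem_pow N (h j)
  obtain ⟨f, hf⟩ := exists_sub_mem_pow_pointIdeal hw N T
  refine ⟨f, fun j => ?_⟩
  have := sub_mem (hT j) (polyGermHom_mem_pow (hf j))
  rwa [map_sub, sub_sub, add_sub_cancel] at this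

theorem mem_polyIdeal_of_polyGermHom_mem (hw : Function.Injective w)
    (hzero : Set.range w = zeroSet p) {f : MvPolynomial (Fin n) ℂ}
    (hf : ∀ j, polyGermHom (w j) f ∈ localIdeal p (w j)) : f ∈ polyIdeal p := by
  obtain ⟨M, hM⟩ := exists_mem_polyIdeal_of_mem_sup hw hzero
  exact hM f fun j => mem_sup_of_polyGermHom_mem (hf j) M

theorem mk_combination {N : ℕ} (β : Fin N → Fin n →₀ ℕ) (α : Fin N → ℂ) :
    Ideal.Quotient.mk (polyIdeal p) (combination β α) = ∑ k, α k • monomialClass p (β k) := by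
  rw [combination, map_sum]
  refine Finset.sum_congr rfl fun k _ => ?_
  rw [monomialClass, ← Ideal.Quotient.mkₐ_eq_mk ℂ, ← map_smul, smul_monomial, smul_eq_mul, mul_one]

theorem combination_injective {N : ℕ} {β : Fin N → Fin n →₀ ℕ} (hβ : IsMonomialBasis p β)
    {α α' : Fin N → ℂ} (h : Ideal.Quotient.mk (polyIdeal p) (combination β α) =
      Ideal.Quotient.mk (polyIdeal p) (combination β α')) : α = α' := by
  rw [mk_combination, mk_combination, ← sub_eq_zero, ← Finset.sum_sub_distrib] at h
  simp only [← sub_smul] at h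
  funext k
  exact sub_eq_zero.mp (Fintype.linearIndependent_iff.mp hβ.1 (fun k => α k - α' k) h k)

theorem exists_combination {N : ℕ} {β : Fin N → Fin n →₀ ℕ} (hβ : IsMonomialBasis p β)
    (f : MvPolynomial (Fin n) ℂ) :
    ∃ α, Ideal.Quotient.mk (polyIdeal p) (combination β α) = Ideal.Quotient.mk (polyIdeal p) f := by
  have h : Ideal.Quotient.mk (polyIdeal p) f ∈
      Submodule.span ℂ (Set.range fun k => monomialClass p (β k)) := hβ.2 ▸ Submodule.mem_top
  obtain ⟨α, hα⟩ := (Submodule.mem_span_range_iff_exists_fun ℂ).mp h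
  exact ⟨α, (mk_combination β α).trans hα⟩

theorem polyGermHom_sub_mem_localIdeal {f g : MvPolynomial (Fin n) ℂ} (x : Fin n → ℂ)
    (h : Ideal.Quotient.mk (polyIdeal p) f = Ideal.Quotient.mk (polyIdeal p) g) :
    polyGermHom x f - polyGermHom x g ∈ localIdeal p x := by
  rw [← map_sub, localIdeal_eq_map]
  exact Ideal.mem_map_of_mem _ (Ideal.Quotient.eq.mp h)

theorem existsUnique_interpolates {N : ℕ} (hw : Function.Injective w)
    (hzero : Set.range w = zeroSet p) {β : Fin N → Fin n →₀ ℕ} (hβ : IsMonomialBasis p β)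
    (h : ∀ j, HolGerm (w j)) : ∃! α, Interpolates p w β h α := by
  obtain ⟨M, hM⟩ := exists_germIdeal_pow_le_localIdeal hw hzero
  obtain ⟨T, hT⟩ := exists_sub_polyGermHom_mem_pow_forall hw M h
  obtain ⟨α, hα⟩ := exists_combination hβ T
  have hint : Interpolates p w β h α := fun j => by
    have := add_mem (hM j (hT j)) (polyGermHom_sub_mem_localIdeal (w j) hα.symm)
    rwa [sub_add_sub_cancel] at this
  refine ⟨α, hint, fun α' h' => combination_injective hβ ?_⟩
  refine Ideal.Quotient.eq.mpr (mem_polyIdeal_of_polyGermHom_mem hw hzero fun j => ?_)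
  have := sub_mem (hint j) (h' j)
  rwa [sub_sub_sub_cancel_left, ← polyGermHom_apply, ← polyGermHom_apply, ← map_sub] at this

theorem degree_lt_of_mem_noetherianSupport {Q : MvPolynomial (Fin n) ℂ} {N : ℕ}
    (hN : Q.totalDegree < N) {l : Fin n →₀ ℕ} (hl : l ∈ noetherianSupport Q) : l.degree < N := by
  obtain ⟨k, hk, hlk⟩ := mem_noetherianSupport.mp hl
  exact ((Finsupp.degree_mono hlk).trans (le_totalDegree hk)).trans_lt hN

theorem evalAt_polyIterPartial_map_C (x : Fin n → ℂ) (l : Fin n →₀ ℕ)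
    (T : MvPolynomial (Fin n) ℂ) :
    evalAt x (polyIterPartial l (map C T : MvPolynomial (Fin n) (MvPolynomial (Fin n) ℂ))) =
      C (evalAt x (polyIterPartial l T)) := by
  have h := taylorCoeff_map (R := MvPolynomial (Fin n) ℂ) x l T
  rw [algebraMap_eq] at h
  rw [evalAt_polyIterPartial, evalAt_polyIterPartial, h, smul_eq_mul, C_mul, smul_eq_C_mul]

theorem applyPoly_map_C (Q : MvPolynomial (Fin n) ℂ) (x : Fin n → ℂ)
    (T : MvPolynomial (Fin n) ℂ) :
    applyPoly Q x (map C T : MvPolynomial (Fin n) (MvPolynomial (Fin n) ℂ)) =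
      C (applyPoly Q x T) := by
  simp only [applyPoly, evalAt_polyIterPartial_map_C, map_sum, smul_eq_C_mul, smul_eq_mul, C_mul]

theorem lagrange_eq {Q : Fin m → MvPolynomial (Fin n) ℂ}
    (B : Matrix (Fin n) (Fin n) (MvPolynomial (Fin n) (MvPolynomial (Fin n) ℂ)))
    {h : ∀ j, HolGerm (w j)} {N : ℕ} (hN : ∀ j, (Q j).totalDegree < N)
    {T : MvPolynomial (Fin n) ℂ} (hT : ∀ j, h j - polyGermHom (w j) T ∈ germIdeal (w j) ^ N) :
    lagrange w Q B h = ∑ j, applyPoly (Q j) (w j) (map C T * B.det) := by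
  refine Finset.sum_congr rfl fun j _ => ?_
  rw [applyPoly_mul]
  refine Finset.sum_congr rfl fun l hl => ?_
  rw [germDeriv_eq_evalAt (hT j) (degree_lt_of_mem_noetherianSupport (hN j) hl),
    evalAt_polyIterPartial_map_C]

/-- The Leibniz formula with the two factors exchanged; the common right-hand side with
`lagrange_eq` is why the two forms coincide. -/
theorem lagrange'_eq {Q : Fin m → MvPolynomial (Fin n) ℂ}
    (B : Matrix (Fin n) (Fin n) (MvPolynomial (Fin n) (MvPolynomial (Fin n) ℂ)))
    {h : ∀ j, HolGerm (w j)} {N : ℕ} (hN : ∀ j, (Q j).totalDegree < N)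
    {T : MvPolynomial (Fin n) ℂ} (hT : ∀ j, h j - polyGermHom (w j) T ∈ germIdeal (w j) ^ N) :
    lagrange' w Q B h = ∑ j, applyPoly (Q j) (w j) (map C T * B.det) := by
  refine Finset.sum_congr rfl fun j _ => ?_
  rw [mul_comm, applyPoly_mul]
  refine Finset.sum_congr rfl fun l _ => ?_
  rw [applyPoly_map_C]
  congr 2
  refine Finset.sum_congr rfl fun k hk => ?_
  rw [germDeriv_eq_evalAt (hT j) (degree_lt_of_mem_noetherianSupport (hN j)
    (support_noetherianComponent_subset _ _ hk)), smul_eq_mul]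

theorem lagrange_eq_lagrange' (hw : Function.Injective w) (Q : Fin m → MvPolynomial (Fin n) ℂ)
    (B : Matrix (Fin n) (Fin n) (MvPolynomial (Fin n) (MvPolynomial (Fin n) ℂ)))
    (h : ∀ j, HolGerm (w j)) : lagrange w Q B h = lagrange' w Q B h := by
  have hN : ∀ j, (Q j).totalDegree < ∑ j, (Q j).totalDegree + 1 := fun j =>
    Nat.lt_succ_of_le (Finset.single_le_sum (f := fun j => (Q j).totalDegree)
      (fun _ _ => Nat.zero_le _) (Finset.mem_univ j))
  obtain ⟨T, hT⟩ := exists_sub_polyGermHom_mem_pow_forall hw _ h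
  rw [lagrange_eq B hN hT, lagrange'_eq B hN hT]

/-- The class of the Lagrange interpolator is the class of the polynomial that interpolates. -/
theorem mk_lagrange (hm : 0 < m) (hw : Function.Injective w) (hzero : Set.range w = zeroSet p)
    {N : ℕ} {β : Fin N → Fin n →₀ ℕ} {h : ∀ j, HolGerm (w j)} {α : Fin N → ℂ}
    {Q : Fin m → MvPolynomial (Fin n) ℂ}
    {B : Matrix (Fin n) (Fin n) (MvPolynomial (Fin n) (MvPolynomial (Fin n) ℂ))}
    (hα : Interpolates p w β h α) (hQ : RepresentsResidue p w Q) (hB : IsBezoutian p B) :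
    Ideal.Quotient.mk (polyIdeal p) (lagrange w Q B h) =
      Ideal.Quotient.mk (polyIdeal p) (combination β α) := by
  obtain ⟨q, A, hA⟩ := exists_isUnivariateReduction hw hzero
  obtain ⟨M, hM⟩ := exists_germIdeal_pow_le_localIdeal hw hzero
  -- The order exceeds the degrees of the symbols, so that T has the derivatives of h that matter,
  -- and is at least M, so that T agrees with h modulo the local ideals.
  have hN : ∀ j, (Q j).totalDegree < M + ∑ j, (Q j).totalDegree + 1 := fun j => by
    have := Finset.single_le_sum (f := fun j => (Q j).totalDegree)
      (fun _ _ => Nat.zero_le _) (Finset.mem_univ j)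
    omega
  obtain ⟨T, hT⟩ := exists_sub_polyGermHom_mem_pow_forall hw _ h
  rw [lagrange_eq B hN hT, sum_applyPoly_eq_extend (lam := residueForm q A)
    fun g => (residueVia_eq q A g).symm.trans (hQ q A hA g),
    extend_residueForm_mul_det (polyIdeal_ne_top hm hzero) hA hB]
  refine Ideal.Quotient.eq.mpr (mem_polyIdeal_of_polyGermHom_mem hw hzero fun j => ?_)
  have := sub_mem (hα j) (hM j (Ideal.pow_le_pow_right (by omega) (hT j)))
  rwa [sub_sub_sub_cancel_left, ← polyGermHom_apply, ← map_sub] at this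

end Interpolation

end ResidueInterpolation

end

theorem mainTheorem3 {n m : ℕ}
    -- a system of `n` polynomials in `n` variables whose zeros are `w₁, …, wₘ`, distinct, `m ≥ 1`
    (p : Fin n → MvPolynomial (Fin n) ℂ) (w : Fin m → Fin n → ℂ)
    (hm : 0 < m) (hw : Function.Injective w)
    (hzero : Set.range w = ResidueInterpolation.zeroSet p)
    -- a monomial basis of `ℂ[s] / (p)`
    (β : Fin (ResidueInterpolation.quotDim p) → Fin n →₀ ℕ)
    (hβ : ResidueInterpolation.IsMonomialBasis p β)
    -- a list of germs of holomorphic functions at the zeros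
    (h : ∀ j, ResidueInterpolation.HolGerm (w j)) :
    -- existence and uniqueness of the coordinates
    (∃! α : Fin (ResidueInterpolation.quotDim p) → ℂ,
      ResidueInterpolation.Interpolates p w β h α) ∧
    -- existence and uniqueness of the operators that represent the residue
    (∃! Q : Fin m → MvPolynomial (Fin n) ℂ, ResidueInterpolation.RepresentsResidue p w Q) ∧
    -- Bézoutian matrices exist
    (∃ B : Matrix (Fin n) (Fin n) (MvPolynomial (Fin n) (MvPolynomial (Fin n) ℂ)),
      ResidueInterpolation.IsBezoutian p B) ∧
    -- the coordinates are those of the class of the Lagrange interpolator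
    ∀ (α : Fin (ResidueInterpolation.quotDim p) → ℂ) (Q : Fin m → MvPolynomial (Fin n) ℂ)
      (B : Matrix (Fin n) (Fin n) (MvPolynomial (Fin n) (MvPolynomial (Fin n) ℂ))),
      ResidueInterpolation.Interpolates p w β h α →
      ResidueInterpolation.RepresentsResidue p w Q →
      ResidueInterpolation.IsBezoutian p B →
        ResidueInterpolation.lagrange w Q B h = ResidueInterpolation.lagrange' w Q B h ∧
        Ideal.Quotient.mk (ResidueInterpolation.polyIdeal p)
            (ResidueInterpolation.lagrange w Q B h) =
          ∑ k, α k • ResidueInterpolation.monomialClass p (β k) := by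
  open ResidueInterpolation in
  exact ⟨existsUnique_interpolates hw hzero hβ h, existsUnique_representsResidue hm hw hzero,
    exists_isBezoutian p, fun α Q B hα hQ hB => ⟨lagrange_eq_lagrange' hw Q B h,
      (mk_lagrange hm hw hzero hα hQ hB).trans (mk_combination β α)⟩⟩
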